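/- For an open set $\Omega\subset\mathbb R^2$, let $H_0^1(\Omega)$ be the closure of $C_c^\infty(\Omega)$ in $H^1(\Omega)$, let $|\Omega|$ be the Lebesgue measure of $\Omega$, and let the Poincaré constant $C_P(\Omega)$ be the least $k\ge 0$ such that $\|u\|_{L^2(\Omega)}\le k\,\|\nabla u\|_{L^2(\Omega)}$ for all $u\in H_0^1(\Omega)$. For every $C'\ge 1$ and every real $p>2$ there exist constants $c>0$ and $C>0$, depending only on $C'$ and $p$, such that the following holds. Let $\varepsilon>0$, let $\Omega\subset\mathbb R^2$ be a bounded open set with $C_P(\Omega)^2\le (C')^2\varepsilon^2$, and let $W_1,W_2\in L^\infty(\Omega;\mathbb R^2)$ and $V\in L^\infty(\Omega;\mathbb R)$ satisfy $$\varepsilon+\varepsilon^{2/p}\|W_1\|_{L^\infty(\Omega)}+\varepsilon\|W_2\|_{L^\infty(\Omega)}+\varepsilon^2\|V\|_{L^\infty(\Omega)}\le c.$$ Then there is a unique (up to equality almost everywhere) real-valued $\varphi\in H^1(\Omega)$ with $\varphi-1\in H_0^1(\Omega)$ that is a weak solution of $$-\Delta\varphi-\nabla\cdot(W_1\varphi)+W_2\cdot\nabla\varphi+V\varphi=0\quad\text{in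 }\Omega,$$ that is, $\int_\Omega\big(\nabla\varphi\cdot\nabla\eta+\varphi\,W_1\cdot\nabla\eta+(W_2\cdot\nabla\varphi)\,\eta+V\varphi\,\eta\big)\,dx=0$ for all $\eta\in C_c^\infty(\Omega)$. Moreover, $$\|\varphi-1\|_{L^\infty(\Omega)}\le C\left(\varepsilon^{2/p}\,|\Omega|^{\frac{p-2}{2p}}\,\|W_1\|_{L^\infty(\Omega)}+\varepsilon^2\,\|V\|_{L^\infty(\Omega)}\right).$$ -/

import Mathlib

open MeasureTheory Filter Topology
open scoped ENNReal ContDiff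

noncomputable section

/-- The Euclidean plane `ℝ²`. -/
abbrev Plane : Type := EuclideanSpace ℝ (Fin 2)

/-- `η ∈ C_c^∞(Ω)` (extended by zero to the plane). -/
structure IsTestFunction (Ω : Set Plane) (η : Plane → ℝ) : Prop where
  smooth : ContDiff ℝ ∞ η
  compact : HasCompactSupport η
  support_subset : tsupport η ⊆ Ω

/-- `u ∈ H¹(Ω)` with weak gradient `∇u = G`: both `u` and `G` are in `L²(Ω)` and
`∫_Ω u ∇η = - ∫_Ω η G` for all test functions `η`. -/
structure HasH1Gradient (Ω : Set Plane) (u : Plane → ℝ) (G : Plane → Plane) : Prop where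
  memLp : MemLp u 2 (volume.restrict Ω)
  memLp_grad : MemLp G 2 (volume.restrict Ω)
  integral_eq : ∀ η : Plane → ℝ, IsTestFunction Ω η →
    ∫ x in Ω, u x • gradient η x = - ∫ x in Ω, η x • G x

/-- `u ∈ H₀¹(Ω)` with weak gradient `∇u = G`: `u` is a limit in `H¹(Ω)` of functions
in `C_c^∞(Ω)`. -/
structure HasH01Gradient (Ω : Set Plane) (u : Plane → ℝ) (G : Plane → Plane) : Prop
    extends HasH1Gradient Ω u G where
  approx : ∃ η : ℕ → Plane → ℝ, (∀ n, IsTestFunction Ω (η n)) ∧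
    Tendsto (fun n => eLpNorm (fun x => u x - η n x) 2 (volume.restrict Ω)) atTop (𝓝 0) ∧
    Tendsto (fun n => eLpNorm (fun x => G x - gradient (η n) x) 2 (volume.restrict Ω))
      atTop (𝓝 0)

/-- `u ∈ H₀¹(Ω)`. -/
def MemH01 (Ω : Set Plane) (u : Plane → ℝ) : Prop :=
  ∃ G : Plane → Plane, HasH01Gradient Ω u G

/-- The Poincaré constant `C_P(Ω)`: the least `k` such that
`‖u‖_{L²(Ω)} ≤ k ‖∇u‖_{L²(Ω)}` for all `u ∈ H₀¹(Ω)` (it is `∞` if there is none). -/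
def poincareConstant (Ω : Set Plane) : ℝ≥0∞ :=
  sInf {k : ℝ≥0∞ | ∀ (u : Plane → ℝ) (G : Plane → Plane), HasH01Gradient Ω u G →
    eLpNorm u 2 (volume.restrict Ω) ≤ k * eLpNorm G 2 (volume.restrict Ω)}

/-- The norm of `L^∞(Ω; F)`, as a real number (used only for functions in `L^∞(Ω; F)`). -/
def supNorm {F : Type*} [NormedAddCommGroup F] (Ω : Set Plane) (f : Plane → F) : ℝ :=
  (eLpNorm f ∞ (volume.restrict Ω)).toReal

/-- `φ ∈ H¹(Ω)` is a weak solution of `-Δφ - ∇·(W₁ φ) + W₂·∇φ + V φ = 0` in `Ω`. -/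
def IsWeakSolution (Ω : Set Plane) (W₁ W₂ : Plane → Plane) (V : Plane → ℝ)
    (φ : Plane → ℝ) : Prop :=
  ∃ G : Plane → Plane, HasH1Gradient Ω φ G ∧ ∀ η : Plane → ℝ, IsTestFunction Ω η →
    ∫ x in Ω, (inner ℝ (G x) (gradient η x) + φ x * inner ℝ (W₁ x) (gradient η x)
      + inner ℝ (W₂ x) (G x) * η x + V x * φ x * η x) = 0

end

/-! ### Test functions -/

section TestFunctions

variable {Ω : Set Plane} {η ζ : Plane → ℝ}

/-! Write φ = 1 + u with u ∈ H₀¹(Ω), and let w, w₂, ν be the sup norms of W₁, W₂, V. If e is an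
admissible Poincaré constant and w e + w₂ e + ν e² ≤ 1/2, then Poincaré's inequality bounds all
lower-order terms of the bilinear form by half of ‖∇u‖₂². The form is thus coercive on H₀¹(Ω), and
Lax–Milgram (`existsUnique_forall_inner_eq_zero`) gives existence and uniqueness. Here H₀¹(Ω) is the
closure of the pairs (η, ∇η) in L² × L², a closed subspace of a Hilbert space.

The heart is the bound ‖u‖_∞ ≤ K e (w + ν e) with K absolute (`IsSmallSolution.eLpNorm_top_le`), in
which |Ω| must not appear. Testing with (u − θ)₊ for a smooth barrier θ ≥ 0 bounds ‖∇(u − θ)₊‖₂ by a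
multiple of |{u > θ}|^{1/2} (`l2Norm_gradient_le`). Poincaré's inequality then makes the measure of
a higher superlevel set linear in that of a lower one, while ‖v‖₂ ≤ S‖∇v‖₁ makes it quadratic, which
feeds De Giorgi's iteration (`eq_zero_of_sq_mul_le`). If |u| ≤ M, the paraboloid θ = M|x − x₀|²/R² +
k confines {u > θ} to a ball of radius R, and R comparable to e replaces the size of Ω. One Poincaré
step makes the superlevel set small enough to start the iteration; this yields u ≤ M/2 + (K/4) e (w
+ ν e)(1 + M), up to an arbitrarily small δ. For M = ‖u‖_∞, and with −u treated alike, the terms in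
M are absorbed.

Finally, both 2C'ε (by hypothesis) and a multiple of |Ω|^{1/2} (by Sobolev) are Poincaré constants.
Their minimum e is at most their geometric mean with weights 2/p and 1 − 2/p, which gives the W₁
term; e ≤ 2C'ε gives the V term. -/

lemma gradient_eq_toDual_symm_fderiv (η : Plane → ℝ) :
    gradient η = fun x => (InnerProductSpace.toDual ℝ Plane).symm (fderiv ℝ η x) := rfl

lemma norm_gradient (η : Plane → ℝ) (x : Plane) : ‖gradient η x‖ = ‖fderiv ℝ η x‖ := by
  rw [gradient_eq_toDual_symm_fderiv]; simp

lemma gradient_eq_zero_of_notMem_tsupport {x : Plane} (hx : x ∉ tsupport η) :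
    gradient η x = 0 := by
  rw [gradient_eq_toDual_symm_fderiv]
  have : fderiv ℝ η x = 0 := by
    by_contra hne
    exact hx (tsupport_fderiv_subset ℝ (subset_tsupport _ hne))
  simp [this]

namespace IsTestFunction

lemma continuous_gradient (h : IsTestFunction Ω η) : Continuous (gradient η) := by
  rw [gradient_eq_toDual_symm_fderiv]
  exact (InnerProductSpace.toDual ℝ Plane).symm.continuous.comp
    (h.smooth.continuous_fderiv (by simp))

lemma differentiable (h : IsTestFunction Ω η) : Differentiable ℝ η :=
  h.smooth.differentiable (by simp)

lemma hasCompactSupport_gradient (h : IsTestFunction Ω η) : HasCompactSupport (gradient η) :=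
  HasCompactSupport.intro h.compact fun _ hx => gradient_eq_zero_of_notMem_tsupport hx

lemma eq_zero_of_notMem (h : IsTestFunction Ω η) {x : Plane} (hx : x ∉ Ω) : η x = 0 :=
  image_eq_zero_of_notMem_tsupport fun hx' => hx (h.support_subset hx')

lemma gradient_eq_zero_of_notMem (h : IsTestFunction Ω η) {x : Plane} (hx : x ∉ Ω) :
    gradient η x = 0 :=
  gradient_eq_zero_of_notMem_tsupport fun hx' => hx (h.support_subset hx')

lemma memLp (h : IsTestFunction Ω η) (p : ℝ≥0∞) : MemLp η p (volume.restrict Ω) :=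
  (h.smooth.continuous.memLp_of_hasCompactSupport h.compact).restrict _

lemma memLp_gradient (h : IsTestFunction Ω η) (p : ℝ≥0∞) :
    MemLp (gradient η) p (volume.restrict Ω) :=
  (h.continuous_gradient.memLp_of_hasCompactSupport h.hasCompactSupport_gradient).restrict _

lemma gradient_add (h : IsTestFunction Ω η) (h' : IsTestFunction Ω ζ) :
    gradient (η + ζ) = gradient η + gradient ζ := by
  funext x
  simp only [gradient_eq_toDual_symm_fderiv, Pi.add_apply]
  rw [fderiv_add (h.differentiable x) (h'.differentiable x), map_add]

lemma gradient_smul (h : IsTestFunction Ω η) (c : ℝ) :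
    gradient (c • η) = c • gradient η := by
  funext x
  simp only [gradient_eq_toDual_symm_fderiv, Pi.smul_apply]
  rw [fderiv_const_smul (h.differentiable x), map_smulₛₗ]
  simp

lemma zero (Ω : Set Plane) : IsTestFunction Ω (0 : Plane → ℝ) where
  smooth := contDiff_const
  compact := HasCompactSupport.zero
  support_subset := by simp [tsupport]

lemma add (h : IsTestFunction Ω η) (h' : IsTestFunction Ω ζ) : IsTestFunction Ω (η + ζ) where
  smooth := h.smooth.add h'.smooth
  compact := h.compact.add h'.compact
  support_subset := (tsupport_add η ζ).trans (Set.union_subset h.support_subset h'.support_subset)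

lemma smul (h : IsTestFunction Ω η) (c : ℝ) : IsTestFunction Ω (c • η) where
  smooth := h.smooth.const_smul c
  compact := h.compact.smul_left (f := fun _ => c)
  support_subset := (tsupport_smul_subset_right (fun _ => c) η).trans h.support_subset

/-- Integration by parts against a differentiable function. -/
lemma integral_smul_gradient (h : IsTestFunction Ω η) {f : Plane → ℝ} (hf : ContDiff ℝ ∞ f) :
    ∫ x in Ω, f x • gradient η x = - ∫ x in Ω, η x • gradient f x := by
  have hcf : Continuous (gradient f) := by
    rw [gradient_eq_toDual_symm_fderiv]
    exact (InnerProductSpace.toDual ℝ Plane).symm.continuous.comp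
      (hf.continuous_fderiv (by simp))
  have i1 : Integrable (fun x => f x • gradient η x) :=
    (hf.continuous.smul h.continuous_gradient).integrable_of_hasCompactSupport
      h.hasCompactSupport_gradient.smul_left
  have i2 : Integrable (fun x => η x • gradient f x) :=
    (h.smooth.continuous.smul hcf).integrable_of_hasCompactSupport h.compact.smul_right
  rw [setIntegral_eq_integral_of_forall_compl_eq_zero
      (fun x hx => by rw [h.gradient_eq_zero_of_notMem hx, smul_zero]),
    setIntegral_eq_integral_of_forall_compl_eq_zero
      (fun x hx => by rw [h.eq_zero_of_notMem hx, zero_smul])]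
  -- Pairing with a fixed vector v reduces the vector identity to scalar integration by parts for
  -- the directional derivative along v.
  refine ext_inner_left ℝ fun v => ?_
  rw [inner_neg_right, ← integral_inner i1, ← integral_inner i2]
  have e1 : ∀ x, (fderiv ℝ η x) v = inner ℝ v (gradient η x) := fun x => by
    rw [real_inner_comm, inner_gradient_left]
  have e2 : ∀ x, (fderiv ℝ f x) v = inner ℝ v (gradient f x) := fun x => by
    rw [real_inner_comm, inner_gradient_left]
  have j1 : Integrable (fun x => f x * (fderiv ℝ η x) v) := by
    simpa only [inner_smul_right, ← e1] using i1.const_inner (𝕜 := ℝ) v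
  have j2 : Integrable (fun x => (fderiv ℝ f x) v * η x) := by
    simpa only [inner_smul_right, ← e2, mul_comm] using i2.const_inner (𝕜 := ℝ) v
  have j3 : Integrable (fun x => f x * η x) :=
    (hf.continuous.mul h.smooth.continuous).integrable_of_hasCompactSupport h.compact.mul_left
  simp only [inner_smul_right, ← e1, ← e2]
  rw [integral_mul_fderiv_eq_neg_fderiv_mul_of_integrable j2 j1 j3
    (fun x _ => hf.differentiable (by simp) x) (fun x _ => h.differentiable x)]
  simp only [mul_comm]

lemma integral_gradient (h : IsTestFunction Ω η) : ∫ x in Ω, gradient η x = 0 := by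
  have := h.integral_smul_gradient (f := fun _ => 1) contDiff_const
  simpa using this

lemma hasH01Gradient (h : IsTestFunction Ω η) : HasH01Gradient Ω η (gradient η) where
  memLp := h.memLp 2
  memLp_grad := h.memLp_gradient 2
  integral_eq _ hζ := hζ.integral_smul_gradient h.smooth
  approx := ⟨fun _ => η, fun _ => h, by simp, by simp⟩

end IsTestFunction

end TestFunctions

/-! ### `H₀¹` as a Hilbert space -/

/-- Pairs of a square integrable function and a square integrable vector field on `Ω`. -/
abbrev GraphSpace (Ω : Set Plane) : Type :=
  WithLp 2 (Lp ℝ 2 (volume.restrict Ω) × Lp Plane 2 (volume.restrict Ω))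

/-- The pairs `(η, ∇η)` of test functions and their gradients. -/
noncomputable def testGraph (Ω : Set Plane) : Submodule ℝ (GraphSpace Ω) where
  carrier := {U | ∃ η, IsTestFunction Ω η ∧ U.fst =ᵐ[volume.restrict Ω] η ∧
    U.snd =ᵐ[volume.restrict Ω] gradient η}
  zero_mem' := ⟨0, .zero Ω, Lp.coeFn_zero _ _ _, by
    have : gradient (0 : Plane → ℝ) = 0 := funext fun x => gradient_fun_const x 0
    rw [this]; exact Lp.coeFn_zero _ _ _⟩
  add_mem' := by
    rintro U V ⟨η, hη, h1, h2⟩ ⟨ζ, hζ, h3, h4⟩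
    refine ⟨η + ζ, hη.add hζ, ?_, ?_⟩
    · exact (Lp.coeFn_add U.fst V.fst).trans (h1.add h3)
    · rw [hη.gradient_add hζ]
      exact (Lp.coeFn_add U.snd V.snd).trans (h2.add h4)
  smul_mem' := by
    rintro c U ⟨η, hη, h1, h2⟩
    refine ⟨c • η, hη.smul c, ?_, ?_⟩
    · exact (Lp.coeFn_smul c U.fst).trans (h1.const_smul c)
    · rw [hη.gradient_smul c]
      exact (Lp.coeFn_smul c U.snd).trans (h2.const_smul c)

/-- The graph `{(u, ∇u) : u ∈ H₀¹(Ω)}`. -/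
noncomputable def sobolevGraph (Ω : Set Plane) : Submodule ℝ (GraphSpace Ω) :=
  (testGraph Ω).topologicalClosure

lemma isClosed_sobolevGraph (Ω : Set Plane) : IsClosed (sobolevGraph Ω : Set (GraphSpace Ω)) :=
  (testGraph Ω).isClosed_topologicalClosure

lemma tendsto_graphSpace_iff {Ω : Set Plane} {U : ℕ → GraphSpace Ω} {V : GraphSpace Ω} :
    Tendsto U atTop (𝓝 V) ↔
      Tendsto (fun n => eLpNorm (fun x => (U n).fst x - V.fst x) 2 (volume.restrict Ω)) atTop (𝓝 0) ∧
      Tendsto (fun n => eLpNorm (fun x => (U n).snd x - V.snd x) 2 (volume.restrict Ω)) atTop (𝓝 0) := by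
  have h1 := Lp.tendsto_Lp_iff_tendsto_eLpNorm' (fi := atTop) (fun n => (U n).fst) V.fst
  have h2 := Lp.tendsto_Lp_iff_tendsto_eLpNorm' (fi := atTop) (fun n => (U n).snd) V.snd
  refine Iff.trans ?_ (h1.and h2)
  rw [(WithLp.homeomorphProd 2 (Lp ℝ 2 (volume.restrict Ω))
      (Lp Plane 2 (volume.restrict Ω))).isInducing.tendsto_nhds_iff, nhds_prod_eq,
    tendsto_prod_iff']
  rfl

/-! ### Weak gradients and the closed graph: two descriptions of H₀¹. -/

section Graph

variable {Ω : Set Plane} {u v : Plane → ℝ} {G H : Plane → Plane}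

lemma integrable_smul_of_memLp {f : Plane → ℝ} {g : Plane → Plane} {μ : Measure Plane}
    (hf : MemLp f 2 μ) (hg : MemLp g 2 μ) : Integrable (fun x => f x • g x) μ :=
  memLp_one_iff_integrable.1 (hg.smul hf)

lemma integrable_inner_of_memLp {f g : Plane → Plane} {μ : Measure Plane}
    (hf : MemLp f 2 μ) (hg : MemLp g 2 μ) : Integrable (fun x => inner ℝ (f x) (g x)) μ := by
  refine (hf.norm.integrable_mul hg.norm).mono (hf.1.inner hg.1) (.of_forall fun x => ?_)
  simpa using norm_inner_le_norm (𝕜 := ℝ) (f x) (g x)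

/-- A weak equation tested against test functions can be tested against `H₀¹(Ω)`. -/
lemma integral_eq_zero_of_mem_sobolevGraph {P : Plane → Plane} {Q : Plane → ℝ}
    (hP : MemLp P 2 (volume.restrict Ω)) (hQ : MemLp Q 2 (volume.restrict Ω))
    (h : ∀ η, IsTestFunction Ω η → ∫ x in Ω, (inner ℝ (P x) (gradient η x) + Q x * η x) = 0)
    {U : GraphSpace Ω} (hU : U ∈ sobolevGraph Ω) :
    ∫ x in Ω, (inner ℝ (P x) (U.snd x) + Q x * U.fst x) = 0 := by
  set T : GraphSpace Ω := WithLp.toLp 2 (hQ.toLp Q, hP.toLp P)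
  have key : ∀ U : GraphSpace Ω,
      inner ℝ T U = ∫ x in Ω, (inner ℝ (P x) (U.snd x) + Q x * U.fst x) := by
    intro U
    rw [WithLp.prod_inner_apply, L2.inner_def, L2.inner_def, ← integral_add]
    · refine integral_congr_ae ?_
      filter_upwards [hP.coeFn_toLp, hQ.coeFn_toLp] with x h1 h2
      change inner ℝ ((hQ.toLp Q : Lp ℝ 2 _) x) (U.fst x) +
        inner ℝ ((hP.toLp P : Lp Plane 2 _) x) (U.snd x) = _
      rw [h1, h2, add_comm]
      simp [mul_comm]
    · exact L2.integrable_inner _ _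
    · exact L2.integrable_inner _ _
  rw [← key]
  have hc : IsClosed {U : GraphSpace Ω | inner ℝ T U = 0} :=
    isClosed_eq (continuous_const.inner continuous_id) continuous_const
  refine closure_minimal (t := {U : GraphSpace Ω | inner ℝ T U = 0}) ?_ hc hU
  rintro V ⟨η, hη, h1, h2⟩
  rw [Set.mem_ofPred_eq, key, ← h η hη]
  refine integral_congr_ae ?_
  filter_upwards [h1, h2] with x h1 h2
  rw [h1, h2]

/-- For fixed ζ and v, integration by parts says that a functional of the form treated in
`integral_eq_zero_of_mem_sobolevGraph` vanishes, with P = ζ v and Q = v·∇ζ. It vanishes on test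
functions, hence on their closure. -/
lemma hasH1Gradient_of_mem_sobolevGraph {U : GraphSpace Ω} (hU : U ∈ sobolevGraph Ω) :
    HasH1Gradient Ω U.fst U.snd where
  memLp := Lp.memLp _
  memLp_grad := Lp.memLp _
  integral_eq ζ hζ := by
    have i1 := integrable_smul_of_memLp (Lp.memLp U.fst) (hζ.memLp_gradient 2)
    have i2 := integrable_smul_of_memLp (hζ.memLp 2) (Lp.memLp U.snd)
    refine ext_inner_left ℝ fun v => ?_
    rw [inner_neg_right, ← integral_inner i1, ← integral_inner i2, ← sub_eq_zero, sub_neg_eq_add,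
      ← integral_add (i1.const_inner v) (i2.const_inner v)]
    have hP : MemLp (fun x => ζ x • v) 2 (volume.restrict Ω) := by
      have := (ContinuousLinearMap.toSpanSingleton ℝ v).comp_memLp' (hζ.memLp 2)
      simpa [Function.comp_def] using this
    have hQ : MemLp (fun x => inner ℝ v (gradient ζ x)) 2 (volume.restrict Ω) :=
      (hζ.memLp_gradient 2).const_inner v
    have := integral_eq_zero_of_mem_sobolevGraph hP hQ (fun η hη => ?_) hU
    · rw [← this]
      refine integral_congr_ae (.of_forall fun x => ?_)
      simp only [inner_smul_right, inner_smul_left, conj_trivial]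
      ring
    · have h1 := hζ.integral_smul_gradient hη.smooth
      have k1 := integrable_smul_of_memLp (hη.memLp 2) (hζ.memLp_gradient 2)
      have k2 := integrable_smul_of_memLp (hζ.memLp 2) (hη.memLp_gradient 2)
      have h2 := congrArg (inner ℝ v) h1
      rw [inner_neg_right, ← integral_inner k1, ← integral_inner k2, ← sub_eq_zero, sub_neg_eq_add,
        ← integral_add (k1.const_inner v) (k2.const_inner v)] at h2
      rw [← h2]
      refine integral_congr_ae (.of_forall fun x => ?_)
      simp only [inner_smul_right, inner_smul_left, conj_trivial]
      ring

/-- With the converse `HasH01Gradient.toGraph_mem`, this lets linear operations and limits in H₀¹ be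
carried out in a closed subspace of a Hilbert space. -/
lemma hasH01Gradient_of_mem_sobolevGraph {U : GraphSpace Ω} (hU : U ∈ sobolevGraph Ω) :
    HasH01Gradient Ω U.fst U.snd where
  toHasH1Gradient := hasH1Gradient_of_mem_sobolevGraph hU
  approx := by
    obtain ⟨V, hV, hlim⟩ := mem_closure_iff_seq_limit.1 hU
    choose η hη h1 h2 using hV
    obtain ⟨l1, l2⟩ := tendsto_graphSpace_iff.1 hlim
    refine ⟨η, hη, l1.congr fun n => ?_, l2.congr fun n => ?_⟩
    · rw [← eLpNorm_neg]
      refine eLpNorm_congr_ae ?_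
      filter_upwards [h1 n] with x hx
      simp [hx]
    · rw [← eLpNorm_neg]
      refine eLpNorm_congr_ae ?_
      filter_upwards [h2 n] with x hx
      simp [hx]

lemma HasH01Gradient.congr (h : HasH01Gradient Ω u G) (hu : u =ᵐ[volume.restrict Ω] v)
    (hG : G =ᵐ[volume.restrict Ω] H) : HasH01Gradient Ω v H where
  memLp := h.memLp.ae_eq hu
  memLp_grad := h.memLp_grad.ae_eq hG
  integral_eq η hη := by
    have e1 : ∫ x in Ω, v x • gradient η x = ∫ x in Ω, u x • gradient η x :=
      integral_congr_ae (by filter_upwards [hu] with x hx; rw [hx])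
    have e2 : ∫ x in Ω, η x • H x = ∫ x in Ω, η x • G x :=
      integral_congr_ae (by filter_upwards [hG] with x hx; rw [hx])
    rw [e1, e2, h.integral_eq η hη]
  approx := by
    obtain ⟨η, hη, l1, l2⟩ := h.approx
    refine ⟨η, hη, l1.congr fun n => eLpNorm_congr_ae ?_, l2.congr fun n => eLpNorm_congr_ae ?_⟩
    · filter_upwards [hu] with x hx; rw [hx]
    · filter_upwards [hG] with x hx; rw [hx]

/-- A function with its weak gradient, as an element of the graph space. -/
noncomputable def HasH1Gradient.toGraph (h : HasH1Gradient Ω u G) : GraphSpace Ω :=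
  WithLp.toLp 2 (h.memLp.toLp, h.memLp_grad.toLp)

lemma HasH1Gradient.coeFn_toGraph_fst (h : HasH1Gradient Ω u G) :
    h.toGraph.fst =ᵐ[volume.restrict Ω] u := h.memLp.coeFn_toLp

lemma HasH1Gradient.coeFn_toGraph_snd (h : HasH1Gradient Ω u G) :
    h.toGraph.snd =ᵐ[volume.restrict Ω] G := h.memLp_grad.coeFn_toLp

lemma toGraph_mem_of_approx (h : HasH1Gradient Ω u G) {η : ℕ → Plane → ℝ}
    (hη : ∀ n, IsTestFunction Ω (η n))
    (l1 : Tendsto (fun n => eLpNorm (fun x => u x - η n x) 2 (volume.restrict Ω)) atTop (𝓝 0))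
    (l2 : Tendsto (fun n => eLpNorm (fun x => G x - gradient (η n) x) 2 (volume.restrict Ω))
      atTop (𝓝 0)) : h.toGraph ∈ sobolevGraph Ω := by
  refine mem_closure_iff_seq_limit.2 ⟨fun n => (hη n).hasH01Gradient.toGraph,
    fun n => ⟨η n, hη n, HasH1Gradient.coeFn_toGraph_fst _, HasH1Gradient.coeFn_toGraph_snd _⟩,
    tendsto_graphSpace_iff.2 ⟨l1.congr fun n => ?_, l2.congr fun n => ?_⟩⟩
  · rw [← eLpNorm_neg]
    refine eLpNorm_congr_ae ?_
    filter_upwards [h.coeFn_toGraph_fst, (hη n).hasH01Gradient.coeFn_toGraph_fst] with x h1 h2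
    simp [h1, h2]
  · rw [← eLpNorm_neg]
    refine eLpNorm_congr_ae ?_
    filter_upwards [h.coeFn_toGraph_snd, (hη n).hasH01Gradient.coeFn_toGraph_snd] with x h1 h2
    simp [h1, h2]

lemma HasH01Gradient.toGraph_mem (h : HasH01Gradient Ω u G) : h.toGraph ∈ sobolevGraph Ω := by
  obtain ⟨η, hη, l1, l2⟩ := h.approx
  exact toGraph_mem_of_approx h.toHasH1Gradient hη l1 l2

lemma HasH01Gradient.sub (h : HasH01Gradient Ω u G) (h' : HasH01Gradient Ω v H) :
    HasH01Gradient Ω (fun x => u x - v x) (fun x => G x - H x) := by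
  refine (hasH01Gradient_of_mem_sobolevGraph
    ((sobolevGraph Ω).sub_mem h.toGraph_mem h'.toGraph_mem)).congr ?_ ?_
  · refine (Lp.coeFn_sub h.toGraph.fst h'.toGraph.fst).trans ?_
    filter_upwards [h.coeFn_toGraph_fst, h'.coeFn_toGraph_fst] with x h1 h2
    simp [h1, h2]
  · refine (Lp.coeFn_sub h.toGraph.snd h'.toGraph.snd).trans ?_
    filter_upwards [h.coeFn_toGraph_snd, h'.coeFn_toGraph_snd] with x h1 h2
    simp [h1, h2]

lemma HasH01Gradient.neg (h : HasH01Gradient Ω u G) :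
    HasH01Gradient Ω (fun x => - u x) (fun x => - G x) := by
  refine (hasH01Gradient_of_mem_sobolevGraph
    ((sobolevGraph Ω).neg_mem h.toGraph_mem)).congr ?_ ?_
  · refine (Lp.coeFn_neg h.toGraph.fst).trans ?_
    filter_upwards [h.coeFn_toGraph_fst] with x h1
    simp [h1]
  · refine (Lp.coeFn_neg h.toGraph.snd).trans ?_
    filter_upwards [h.coeFn_toGraph_snd] with x h1
    simp [h1]

/-- `H₀¹(Ω)` is closed in `H¹(Ω)`. -/
lemma HasH01Gradient.of_tendsto {u' : ℕ → Plane → ℝ} {G' : ℕ → Plane → Plane}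
    (h : ∀ n, HasH01Gradient Ω (u' n) (G' n))
    (hu : MemLp u 2 (volume.restrict Ω)) (hG : MemLp G 2 (volume.restrict Ω))
    (l1 : Tendsto (fun n => eLpNorm (fun x => u' n x - u x) 2 (volume.restrict Ω)) atTop (𝓝 0))
    (l2 : Tendsto (fun n => eLpNorm (fun x => G' n x - G x) 2 (volume.restrict Ω)) atTop (𝓝 0)) :
    HasH01Gradient Ω u G := by
  have hmem : (WithLp.toLp 2 (hu.toLp, hG.toLp) : GraphSpace Ω) ∈ sobolevGraph Ω := by
    refine (isClosed_sobolevGraph Ω).mem_of_tendsto (f := fun n => (h n).toGraph)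
      (tendsto_graphSpace_iff.2 ⟨l1.congr fun n => ?_, l2.congr fun n => ?_⟩)
      (.of_forall fun n => (h n).toGraph_mem)
    · refine eLpNorm_congr_ae ?_
      filter_upwards [hu.coeFn_toLp, (h n).coeFn_toGraph_fst] with x h1 h2
      simp [h1, h2]
    · refine eLpNorm_congr_ae ?_
      filter_upwards [hG.coeFn_toLp, (h n).coeFn_toGraph_snd] with x h1 h2
      simp [h1, h2]
  exact (hasH01Gradient_of_mem_sobolevGraph hmem).congr hu.coeFn_toLp hG.coeFn_toLp

/-- A weak equation tested against test functions can be tested against `H₀¹(Ω)`. -/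
lemma HasH01Gradient.integral_eq_zero (hv : HasH01Gradient Ω v H) {P : Plane → Plane}
    {Q : Plane → ℝ}
    (hP : MemLp P 2 (volume.restrict Ω)) (hQ : MemLp Q 2 (volume.restrict Ω))
    (h : ∀ η, IsTestFunction Ω η → ∫ x in Ω, (inner ℝ (P x) (gradient η x) + Q x * η x) = 0) :
    ∫ x in Ω, (inner ℝ (P x) (H x) + Q x * v x) = 0 := by
  rw [← integral_eq_zero_of_mem_sobolevGraph hP hQ h hv.toGraph_mem]
  refine integral_congr_ae ?_
  filter_upwards [hv.coeFn_toGraph_fst, hv.coeFn_toGraph_snd] with x h1 h2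
  rw [h1, h2]

/-- Weak gradients are unique. -/
lemma HasH1Gradient.gradient_unique (hΩ : IsOpen Ω) (h : HasH1Gradient Ω u G)
    (h' : HasH1Gradient Ω u H) : G =ᵐ[volume.restrict Ω] H := by
  have hloc : LocallyIntegrableOn (fun x => G x - H x) Ω := by
    have := (h.memLp_grad.sub h'.memLp_grad).locallyIntegrable (by norm_num)
    exact locallyIntegrableOn_of_locallyIntegrable_restrict this
  have := hΩ.ae_eq_zero_of_integral_contDiff_smul_eq_zero hloc fun g hg1 hg2 hg3 => by
    have ht : IsTestFunction Ω g := ⟨hg1, hg2, hg3⟩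
    rw [← setIntegral_eq_integral_of_forall_compl_eq_zero (s := Ω)
      (fun x hx => by rw [ht.eq_zero_of_notMem hx, zero_smul])]
    simp only [smul_sub]
    rw [integral_sub (integrable_smul_of_memLp (ht.memLp 2) h.memLp_grad)
      (integrable_smul_of_memLp (ht.memLp 2) h'.memLp_grad),
      ← neg_eq_iff_eq_neg.2 (h.integral_eq g ht), ← neg_eq_iff_eq_neg.2 (h'.integral_eq g ht),
      sub_self]
  rw [Filter.EventuallyEq, ae_restrict_iff' hΩ.measurableSet]
  filter_upwards [this] with x hx hxΩ
  exact sub_eq_zero.1 (hx hxΩ)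

/-- Adding a constant does not change the weak gradient. -/
lemma HasH1Gradient.add_const [IsFiniteMeasure (volume.restrict Ω)] (h : HasH1Gradient Ω u G)
    (c : ℝ) : HasH1Gradient Ω (fun x => u x + c) G where
  memLp := h.memLp.add (memLp_const c)
  memLp_grad := h.memLp_grad
  integral_eq η hη := by
    have i : Integrable (gradient η) (volume.restrict Ω) :=
      memLp_one_iff_integrable.1 (hη.memLp_gradient 1)
    simp only [add_smul]
    rw [integral_add (integrable_smul_of_memLp h.memLp (hη.memLp_gradient 2)) (i.fun_smul c),
      integral_smul, hη.integral_gradient, smul_zero, add_zero, h.integral_eq η hη]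

end Graph

/-! ### Truncation in `H₀¹` -/

lemma tendsto_eLpNorm_two_of_dominated {α E : Type*} [MeasurableSpace α] [NormedAddCommGroup E]
    {μ : Measure α} {f : ℕ → α → E} {b : α → ℝ} (hf : ∀ n, AEStronglyMeasurable (f n) μ)
    (hb : MemLp b 2 μ) (hle : ∀ n, ∀ᵐ x ∂μ, ‖f n x‖ ≤ b x)
    (h0 : ∀ᵐ x ∂μ, Tendsto (fun n => f n x) atTop (𝓝 0)) :
    Tendsto (fun n => eLpNorm (f n) 2 μ) atTop (𝓝 0) := by
  have hb2 : ∫⁻ x, ‖b x‖ₑ ^ (2 : ℝ) ∂μ ≠ ⊤ := by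
    have := hb.eLpNorm_ne_top
    rw [eLpNorm_eq_lintegral_rpow_enorm_toReal (by norm_num) (by norm_num)] at this
    intro h
    simp only [ENNReal.toReal_ofNat, h] at this
    simp at this
  have key : Tendsto (fun n => ∫⁻ x, ‖f n x‖ₑ ^ (2 : ℝ) ∂μ) atTop (𝓝 (∫⁻ _, 0 ∂μ)) := by
    refine tendsto_lintegral_of_dominated_convergence' (fun x => ‖b x‖ₑ ^ (2 : ℝ))
      (fun n => (hf n).enorm.pow_const _) (fun n => ?_) hb2 ?_
    · filter_upwards [hle n] with x hx
      gcongr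
      rw [enorm_le_iff_norm_le]
      exact hx.trans (Real.le_norm_self _)
    · filter_upwards [h0] with x hx
      have := ((ENNReal.continuous_rpow_const (y := (2 : ℝ))).tendsto _).comp hx.enorm
      simpa [Function.comp_def] using this
  have := ((ENNReal.continuous_rpow_const (y := (1 / 2 : ℝ))).tendsto _).comp key
  simp only [lintegral_zero] at this
  rw [ENNReal.zero_rpow_of_pos (by norm_num)] at this
  refine this.congr fun n => ?_
  rw [eLpNorm_eq_lintegral_rpow_enorm_toReal (by norm_num) (by norm_num)]
  simp

lemma Continuous.memLp_restrict_of_isBounded {E : Type*} [NormedAddCommGroup E]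
    {Ω : Set Plane} (hb : Bornology.IsBounded Ω)
    {f : Plane → E} (hf : Continuous f) (p : ℝ≥0∞) : MemLp f p (volume.restrict Ω) := by
  have hK : IsCompact (closure Ω) := hb.isCompact_closure
  obtain ⟨C, hC⟩ := hK.exists_bound_of_continuousOn hf.continuousOn
  have : IsFiniteMeasure (volume.restrict (closure Ω)) :=
    isFiniteMeasure_restrict.2 hK.measure_lt_top.ne
  have : MemLp f p (volume.restrict (closure Ω)) := by
    refine MemLp.of_bound (hf.continuousOn.aestronglyMeasurable_of_isCompact hK
      isClosed_closure.measurableSet) C ?_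
    filter_upwards [ae_restrict_mem isClosed_closure.measurableSet] with x hx using hC x hx
  exact this.mono_measure (Measure.restrict_mono subset_closure le_rfl)

lemma continuous_gradient_of_contDiff {f : Plane → ℝ} (hf : ContDiff ℝ ∞ f) :
    Continuous (gradient f) := by
  rw [gradient_eq_toDual_symm_fderiv]
  exact (InnerProductSpace.toDual ℝ Plane).symm.continuous.comp
    (hf.continuous_fderiv (by simp))

section Truncation

variable {Ω : Set Plane} {η θ u : Plane → ℝ} {G : Plane → Plane} {β : ℝ → ℝ}

/-- Off the support of η the argument of β is −θ ≤ 0, where β vanishes. This is why barriers have to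
be nonnegative. -/
lemma IsTestFunction.comp_sub (h : IsTestFunction Ω η) (hβ : ContDiff ℝ ∞ β)
    (hβ0 : ∀ t ≤ 0, β t = 0) (hθ : ContDiff ℝ ∞ θ) (hθ0 : ∀ x, 0 ≤ θ x) :
    IsTestFunction Ω (fun x => β (η x - θ x)) where
  smooth := hβ.comp (h.smooth.sub hθ)
  compact := HasCompactSupport.intro h.compact fun x hx => by
    rw [image_eq_zero_of_notMem_tsupport hx]
    exact hβ0 _ (by linarith [hθ0 x])
  support_subset := by
    refine (closure_mono fun x hx => ?_).trans h.support_subset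
    intro hx0
    exact hx (by
      change β (η x - θ x) = 0
      rw [hx0]
      exact hβ0 _ (by linarith [hθ0 x]))

lemma gradient_comp_sub (hη : Differentiable ℝ η) (hβ : Differentiable ℝ β)
    (hθ : Differentiable ℝ θ) (x : Plane) :
    gradient (fun x => β (η x - θ x)) x
      = deriv β (η x - θ x) • (gradient η x - gradient θ x) := by
  simp only [gradient_eq_toDual_symm_fderiv]
  have h1 : HasFDerivAt (fun x => η x - θ x) (fderiv ℝ η x - fderiv ℝ θ x) x :=
    (hη x).hasFDerivAt.sub (hθ x).hasFDerivAt
  have h2 := (hβ (η x - θ x)).hasDerivAt.comp_hasFDerivAt x h1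
  rw [show (fun x => β (η x - θ x)) = β ∘ (fun x => η x - θ x) from rfl, h2.fderiv]
  simp

/-- The chain rule holds for the approximating test functions and survives the limit, because β is
Lipschitz and β' is bounded and continuous. -/
lemma HasH01Gradient.comp_sub (hb : Bornology.IsBounded Ω) (h : HasH01Gradient Ω u G)
    (hβ : ContDiff ℝ ∞ β) (hβ0 : ∀ t ≤ 0, β t = 0) {L : ℝ} (hL : ∀ t, |deriv β t| ≤ L)
    (hθ : ContDiff ℝ ∞ θ) (hθ0 : ∀ x, 0 ≤ θ x) :
    HasH01Gradient Ω (fun x => β (u x - θ x))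
      (fun x => deriv β (u x - θ x) • (G x - gradient θ x)) := by
  have hL0 : 0 ≤ L := (abs_nonneg _).trans (hL 0)
  have hlip : ∀ a b, ‖β a - β b‖ ≤ L * ‖a - b‖ := fun a b =>
    convex_univ.norm_image_sub_le_of_norm_deriv_le (fun x _ => hβ.differentiable (by simp) x)
      (fun x _ => hL x) (Set.mem_univ b) (Set.mem_univ a)
  have hcd : Continuous (deriv β) := hβ.continuous_deriv (by simp)
  have hmθ := hθ.continuous.memLp_restrict_of_isBounded hb 2
  have hmgθ := (continuous_gradient_of_contDiff hθ).memLp_restrict_of_isBounded hb 2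
  have hmu := h.memLp.sub hmθ
  have hmG := h.memLp_grad.sub hmgθ
  have hsd : ∀ {w : Plane → ℝ}, AEStronglyMeasurable w (volume.restrict Ω) →
      AEStronglyMeasurable (fun x => deriv β (w x - θ x)) (volume.restrict Ω) := fun hw =>
    hcd.comp_aestronglyMeasurable (hw.sub hmθ.1)
  have m1 : MemLp (fun x => β (u x - θ x)) 2 (volume.restrict Ω) := by
    refine hmu.of_le_mul (c := L) (hβ.continuous.comp_aestronglyMeasurable hmu.1)
      (.of_forall fun x => ?_)
    have := hlip (u x - θ x) 0
    simpa [hβ0 0 le_rfl] using this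
  have m2 : MemLp (fun x => deriv β (u x - θ x) • (G x - gradient θ x)) 2
      (volume.restrict Ω) := by
    refine hmG.of_le_mul (c := L) ((hsd h.memLp.1).smul hmG.1) (.of_forall fun x => ?_)
    rw [norm_smul]
    exact mul_le_mul_of_nonneg_right (hL _) (norm_nonneg _)
  obtain ⟨η', hη', l1', l2'⟩ := h.approx
  -- Since β' is merely continuous, convergence of β'(η n − θ) is obtained almost everywhere, along
  -- a subsequence.
  have hae : TendstoInMeasure (volume.restrict Ω) η' atTop u := by
    refine tendstoInMeasure_of_tendsto_eLpNorm (p := 2) (by norm_num)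
      (fun n => ((hη' n).memLp 2).1) h.memLp.1 (l1'.congr fun n => ?_)
    rw [← eLpNorm_neg]
    congr 1
    funext x
    simp
  obtain ⟨ns, hns, hae⟩ := hae.exists_seq_tendsto_ae
  set η := fun n => η' (ns n)
  have hη : ∀ n, IsTestFunction Ω (η n) := fun n => hη' _
  have l1 := l1'.comp hns.tendsto_atTop
  have l2 := l2'.comp hns.tendsto_atTop
  have hgrad : ∀ n x, gradient (fun x => β (η n x - θ x)) x
      = deriv β (η n x - θ x) • (gradient (η n) x - gradient θ x) := fun n x =>
    gradient_comp_sub (hη n).differentiable (hβ.differentiable (by simp))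
      (hθ.differentiable (by simp)) x
  refine HasH01Gradient.of_tendsto
    (fun n => ((hη n).comp_sub hβ hβ0 hθ hθ0).hasH01Gradient) m1 m2 ?_ ?_
  · have : Tendsto (fun n => ENNReal.ofReal L *
        eLpNorm (fun x => u x - η n x) 2 (volume.restrict Ω)) atTop (𝓝 0) := by
      simpa using ENNReal.Tendsto.const_mul l1 (Or.inr ENNReal.ofReal_ne_top)
    refine tendsto_of_tendsto_of_tendsto_of_le_of_le tendsto_const_nhds this
      (fun _ => zero_le) fun n => ?_
    refine eLpNorm_le_mul_eLpNorm_of_ae_le_mul (.of_forall fun x => ?_) 2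
    refine (hlip _ _).trans (le_of_eq ?_)
    rw [norm_sub_rev]
    congr 2
    ring
  · have c1 : Tendsto (fun n => ENNReal.ofReal L *
        eLpNorm (fun x => G x - gradient (η n) x) 2 (volume.restrict Ω)) atTop (𝓝 0) := by
      simpa using ENNReal.Tendsto.const_mul l2 (Or.inr ENNReal.ofReal_ne_top)
    -- The gradient error splits in two: `c1` has bounded β' against an L²-small factor; `c2` has a
    -- fixed L² field against β' differences tending to 0 a.e., handled by dominated convergence.
    have c2 : Tendsto (fun n => eLpNorm (fun x => (deriv β (η n x - θ x) - deriv β (u x - θ x)) •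
        (G x - gradient θ x)) 2 (volume.restrict Ω)) atTop (𝓝 0) := by
      refine tendsto_eLpNorm_two_of_dominated (b := fun x => (2 * L) * ‖G x - gradient θ x‖)
        (fun n => ((hsd ((hη n).memLp 2).1).sub (hsd h.memLp.1)).smul hmG.1)
        (hmG.norm.const_mul _) (fun n => .of_forall fun x => ?_) ?_
      · rw [norm_smul]
        refine mul_le_mul_of_nonneg_right ((norm_sub_le _ _).trans ?_) (norm_nonneg _)
        have h1 := hL (η n x - θ x)
        have h2 := hL (u x - θ x)
        simp only [Real.norm_eq_abs]
        linarith
      · filter_upwards [hae] with x hx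
        have := ((hcd.tendsto (u x - θ x)).comp (hx.sub_const (θ x))).sub_const
          (deriv β (u x - θ x))
        rw [sub_self] at this
        simpa [Function.comp_def] using this.smul_const (G x - gradient θ x)
    have c3 := c1.add c2
    rw [add_zero] at c3
    refine tendsto_of_tendsto_of_tendsto_of_le_of_le tendsto_const_nhds c3
      (fun _ => zero_le) fun n => ?_
    have e : (fun x => gradient (fun x => β (η n x - θ x)) x -
        deriv β (u x - θ x) • (G x - gradient θ x)) =
        (fun x => - (deriv β (η n x - θ x) • (G x - gradient (η n) x))) +
        (fun x => (deriv β (η n x - θ x) - deriv β (u x - θ x)) • (G x - gradient θ x)) := by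
      funext x
      simp only [hgrad, Pi.add_apply]
      module
    rw [e]
    have hmη : MemLp (fun x => G x - gradient (η n) x) 2 (volume.restrict Ω) :=
      h.memLp_grad.sub ((hη n).memLp_gradient 2)
    refine (eLpNorm_add_le ((hsd ((hη n).memLp 2).1).smul hmη.1).neg
      (((hsd ((hη n).memLp 2).1).sub (hsd h.memLp.1)).smul hmG.1) (by norm_num)).trans ?_
    refine add_le_add (eLpNorm_le_mul_eLpNorm_of_ae_le_mul (.of_forall fun x => ?_) 2) le_rfl
    rw [Pi.neg_apply, norm_neg, Pi.smul_apply', norm_smul]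
    exact mul_le_mul_of_nonneg_right (hL _) (norm_nonneg _)

/-- A smooth function vanishing on `(-∞, 0]` and equal to the identity on `(1, ∞)`. -/
lemma exists_smooth_posPart : ∃ (κ : ℝ → ℝ) (L : ℝ), ContDiff ℝ ∞ κ ∧ (∀ t ≤ 0, κ t = 0) ∧
    (∀ t ≤ 0, deriv κ t = 0) ∧ (∀ t, 1 < t → κ t = t) ∧ (∀ t, 1 < t → deriv κ t = 1) ∧
    (∀ t, |deriv κ t| ≤ L) ∧ ∀ t, |κ t| ≤ |t| := by
  have hst : ContDiff ℝ ∞ Real.smoothTransition := Real.smoothTransition.contDiff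
  have hκ : ContDiff ℝ ∞ (fun t : ℝ => t * Real.smoothTransition t) := contDiff_id.mul hst
  have hd0 : ∀ t ≤ 0, deriv (fun t : ℝ => t * Real.smoothTransition t) t = 0 := by
    intro t ht
    rcases ht.lt_or_eq with ht | rfl
    · have : (fun t : ℝ => t * Real.smoothTransition t) =ᶠ[𝓝 t] fun _ => 0 := by
        filter_upwards [gt_mem_nhds ht] with s hs
        rw [Real.smoothTransition.zero_of_nonpos hs.le, mul_zero]
      rw [this.deriv_eq, deriv_const]
    · have := (hasDerivAt_id (0 : ℝ)).mul (hst.differentiable (by simp) 0).hasDerivAt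
      have h2 := this.deriv
      simp only [id, Real.smoothTransition.zero, mul_zero, zero_mul, add_zero] at h2
      exact h2
  have hd1 : ∀ t, 1 < t → deriv (fun t : ℝ => t * Real.smoothTransition t) t = 1 := by
    intro t ht
    have : (fun t : ℝ => t * Real.smoothTransition t) =ᶠ[𝓝 t] fun s => s := by
      filter_upwards [lt_mem_nhds ht] with s hs
      rw [Real.smoothTransition.one_of_one_le hs.le, mul_one]
    rw [this.deriv_eq, deriv_id'']
  obtain ⟨C, hC⟩ := (isCompact_Icc (a := (0 : ℝ)) (b := 1)).exists_bound_of_continuousOn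
    (hκ.continuous_deriv (by simp)).continuousOn
  refine ⟨_, max C 1, hκ, fun t ht => ?_, hd0, fun t ht => ?_, hd1, fun t => ?_, fun t => ?_⟩
  · rw [Real.smoothTransition.zero_of_nonpos ht, mul_zero]
  · rw [Real.smoothTransition.one_of_one_le ht.le, mul_one]
  · rcases le_or_gt t 0 with h | h
    · rw [hd0 t h]; simp
    rcases le_or_gt t 1 with h' | h'
    · exact (hC t ⟨h.le, h'⟩).trans (le_max_left _ _)
    · rw [hd1 t h']; simp
  · rw [abs_mul, abs_of_nonneg (Real.smoothTransition.nonneg t)]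
    exact mul_le_of_le_one_right (abs_nonneg _) (Real.smoothTransition.le_one t)

/-- Truncation above a nonnegative smooth barrier stays in `H₀¹`. -/
lemma HasH01Gradient.posPart_sub (hb : Bornology.IsBounded Ω) (h : HasH01Gradient Ω u G)
    (hum : Measurable u) (hθ : ContDiff ℝ ∞ θ) (hθ0 : ∀ x, 0 ≤ θ x) :
    HasH01Gradient Ω (fun x => max (u x - θ x) 0)
      ({x | θ x < u x}.indicator fun x => G x - gradient θ x) := by
  obtain ⟨κ, L, hκ, hκ0, hd0, hκ1, hd1, hL, hle⟩ := exists_smooth_posPart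
  have hmθ := hθ.continuous.memLp_restrict_of_isBounded hb 2
  have hmgθ := (continuous_gradient_of_contDiff hθ).memLp_restrict_of_isBounded hb 2
  have hmu : MemLp (fun x => u x - θ x) 2 (volume.restrict Ω) := h.memLp.sub hmθ
  have hmG : MemLp (fun x => G x - gradient θ x) 2 (volume.restrict Ω) := h.memLp_grad.sub hmgθ
  have hA : MeasurableSet {x | θ x < u x} := measurableSet_lt hθ.continuous.measurable hum
  have m1 : MemLp (fun x => max (u x - θ x) 0) 2 (volume.restrict Ω) := hmu.pos_part
  have m2 : MemLp ({x | θ x < u x}.indicator fun x => G x - gradient θ x) 2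
      (volume.restrict Ω) := hmG.indicator hA
  -- This rescaling keeps the derivative bound L of κ while the transition layer (0, 1/(n + 1)]
  -- shrinks, so β n tends to the positive part.
  set β : ℕ → ℝ → ℝ := fun n t => κ ((n + 1 : ℝ) * t) / (n + 1)
  have hβ : ∀ n, ContDiff ℝ ∞ (β n) := fun n =>
    (hκ.comp (contDiff_const.mul contDiff_id)).div_const _
  have hβd : ∀ n t, deriv (β n) t = deriv κ ((n + 1 : ℝ) * t) := by
    intro n t
    have hn : (n + 1 : ℝ) ≠ 0 := by positivity
    have h1 := ((hκ.differentiable (by simp) ((n + 1 : ℝ) * t)).hasDerivAt.comp t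
      ((hasDerivAt_id t).const_mul (n + 1 : ℝ))).div_const (n + 1 : ℝ)
    have h2 := h1.deriv
    rw [mul_one, mul_div_assoc, div_self hn, mul_one] at h2
    exact h2
  have hβ0 : ∀ n, ∀ t ≤ 0, β n t = 0 := fun n t ht => by
    change κ _ / _ = 0
    rw [hκ0 _ (mul_nonpos_of_nonneg_of_nonpos (by positivity) ht), zero_div]
  have hev : ∀ t : ℝ, 0 < t → ∀ᶠ n : ℕ in atTop, 1 < (n + 1 : ℝ) * t := fun t ht => by
    have : Tendsto (fun n : ℕ => ((n : ℝ) + 1) * t) atTop atTop :=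
      (tendsto_natCast_atTop_atTop.atTop_add tendsto_const_nhds).atTop_mul_const ht
    exact this.eventually_gt_atTop 1
  have hlim : ∀ t, Tendsto (fun n => β n t) atTop (𝓝 (max t 0)) := by
    intro t
    refine tendsto_const_nhds.congr' ?_
    rcases le_or_gt t 0 with ht | ht
    · filter_upwards with n
      rw [hβ0 n t ht, max_eq_right ht]
    · filter_upwards [hev t ht] with n hn
      change _ = κ _ / _
      rw [hκ1 _ hn, max_eq_left ht.le, mul_div_cancel_left₀ _ (by positivity)]
  -- At t = 0 every derivative is 0, so the limit is the indicator of the strict superlevel set;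
  -- nothing about ∇u on level sets is needed.
  have hlimd : ∀ t, Tendsto (fun n => deriv (β n) t) atTop (𝓝 (if 0 < t then 1 else 0)) := by
    intro t
    refine tendsto_const_nhds.congr' ?_
    rcases le_or_gt t 0 with ht | ht
    · filter_upwards with n
      rw [hβd, hd0 _ (mul_nonpos_of_nonneg_of_nonpos (by positivity) ht), if_neg ht.not_gt]
    · filter_upwards [hev t ht] with n hn
      rw [hβd, hd1 _ hn, if_pos ht]
  have hβle : ∀ n t, |β n t| ≤ |t| := by
    intro n t
    change |κ _ / _| ≤ _
    rw [abs_div, div_le_iff₀ (by positivity)]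
    refine (hle _).trans ?_
    rw [abs_mul, mul_comm]
  have happ : ∀ n, HasH01Gradient Ω (fun x => β n (u x - θ x))
      (fun x => deriv (β n) (u x - θ x) • (G x - gradient θ x)) := fun n =>
    h.comp_sub hb (hβ n) (hβ0 n) (fun t => by rw [hβd]; exact hL _) hθ hθ0
  refine HasH01Gradient.of_tendsto happ m1 m2 ?_ ?_
  · refine tendsto_eLpNorm_two_of_dominated (b := fun x => 2 * ‖u x - θ x‖)
      (fun n => (happ n).memLp.1.sub m1.1) (hmu.norm.const_mul _)
      (fun n => .of_forall fun x => ?_) (.of_forall fun x => ?_)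
    · refine (norm_sub_le _ _).trans ?_
      have h1 := hβle n (u x - θ x)
      have h2 : |max (u x - θ x) 0| ≤ |u x - θ x| := by
        rw [abs_of_nonneg (le_max_right _ _)]
        exact max_le (le_abs_self _) (abs_nonneg _)
      simp only [Real.norm_eq_abs]
      linarith
    · simpa using (hlim (u x - θ x)).sub_const (max (u x - θ x) 0)
  · refine tendsto_eLpNorm_two_of_dominated (b := fun x => (L + 1) * ‖G x - gradient θ x‖)
      (fun n => (happ n).memLp_grad.1.sub m2.1) (hmG.norm.const_mul _)
      (fun n => .of_forall fun x => ?_) (.of_forall fun x => ?_)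
    · refine (norm_sub_le _ _).trans ?_
      rw [norm_smul, add_mul, one_mul]
      refine add_le_add (mul_le_mul_of_nonneg_right ?_ (norm_nonneg _))
        (norm_indicator_le_norm_self _ _)
      rw [hβd]
      exact hL _
    · have := ((hlimd (u x - θ x)).smul_const (G x - gradient θ x)).sub_const
        ({x | θ x < u x}.indicator (fun x => G x - gradient θ x) x)
      have e : (if 0 < u x - θ x then (1 : ℝ) else 0) • (G x - gradient θ x) -
          {x | θ x < u x}.indicator (fun x => G x - gradient θ x) x = 0 := by
        by_cases hx : θ x < u x
        · rw [if_pos (sub_pos.2 hx), Set.indicator_of_mem (by exact hx), one_smul, sub_self]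
        · rw [if_neg (fun h => hx (sub_pos.1 h)), Set.indicator_of_notMem (by exact hx), zero_smul,
            sub_self]
      rw [e] at this
      exact this

end Truncation

/-! ### The Sobolev inequality -/

/-- The constant of the inequality `‖v‖_{L²} ≤ S ‖∇v‖_{L¹}` in the plane. -/
noncomputable def sobolevConst : NNReal := eLpNormLESNormFDerivOneConst (volume : Measure Plane) 2

section Sobolev

variable {Ω : Set Plane} {η v : Plane → ℝ} {H : Plane → Plane}

/-- The Gagliardo–Nirenberg–Sobolev inequality with gradient in L¹; in dimension 2 the conjugate
exponent of the dimension is again 2. -/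
lemma IsTestFunction.eLpNorm_le (h : IsTestFunction Ω η) :
    eLpNorm η 2 (volume.restrict Ω) ≤ sobolevConst * eLpNorm (gradient η) 1 (volume.restrict Ω) := by
  have hp : NNReal.HolderConjugate (Module.finrank ℝ Plane : NNReal) 2 := by
    rw [finrank_euclideanSpace_fin]
    exact NNReal.HolderConjugate.two_two
  have := eLpNorm_le_eLpNorm_fderiv_one (volume : Measure Plane)
    (h.smooth.of_le (by simp)) h.compact hp
  rw [eLpNorm_restrict_eq_of_support_subset, eLpNorm_restrict_eq_of_support_subset]
  · refine this.trans (le_of_eq ?_)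
    congr 1
    exact eLpNorm_congr_norm_ae (.of_forall fun x => (norm_gradient η x).symm)
  · intro x hx
    by_contra hxΩ
    exact hx (h.gradient_eq_zero_of_notMem hxΩ)
  · intro x hx
    by_contra hxΩ
    exact hx (h.eq_zero_of_notMem hxΩ)

lemma HasH01Gradient.eLpNorm_le (hb : Bornology.IsBounded Ω) (h : HasH01Gradient Ω v H) :
    eLpNorm v 2 (volume.restrict Ω) ≤ sobolevConst * eLpNorm H 1 (volume.restrict Ω) := by
  have : IsFiniteMeasure (volume.restrict Ω) := isFiniteMeasure_restrict.2 hb.measure_lt_top.ne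
  obtain ⟨η, hη, l1, l2⟩ := h.approx
  -- The Hölder factor |Ω|^{1/2}: it turns L² convergence of gradients into L¹ convergence and
  -- disappears in the limit.
  set c : ℝ≥0∞ := (volume.restrict Ω) Set.univ ^ (1 / (1 : ℝ≥0∞).toReal - 1 / (2 : ℝ≥0∞).toReal)
  have hc : c ≠ ⊤ := ENNReal.rpow_ne_top_of_nonneg (by norm_num) (measure_ne_top _ _)
  have hlim : Tendsto (fun n => eLpNorm (fun x => v x - η n x) 2 (volume.restrict Ω) +
      sobolevConst * (eLpNorm H 1 (volume.restrict Ω) +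
        eLpNorm (fun x => H x - gradient (η n) x) 2 (volume.restrict Ω) * c)) atTop
      (𝓝 (0 + sobolevConst * (eLpNorm H 1 (volume.restrict Ω) + 0 * c))) :=
    l1.add (ENNReal.Tendsto.const_mul (tendsto_const_nhds.add
      (ENNReal.Tendsto.mul_const l2 (Or.inr hc))) (Or.inr ENNReal.coe_ne_top))
  rw [zero_mul, add_zero, zero_add] at hlim
  refine ge_of_tendsto' hlim fun n => ?_
  have hd := h.memLp_grad.sub ((hη n).memLp_gradient 2)
  calc eLpNorm v 2 (volume.restrict Ω)
      = eLpNorm ((fun x => v x - η n x) + η n) 2 (volume.restrict Ω) := by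
        congr 1; funext x; simp
    _ ≤ eLpNorm (fun x => v x - η n x) 2 (volume.restrict Ω) +
        eLpNorm (η n) 2 (volume.restrict Ω) :=
      eLpNorm_add_le (h.memLp.1.sub ((hη n).memLp 2).1) ((hη n).memLp 2).1 (by norm_num)
    _ ≤ eLpNorm (fun x => v x - η n x) 2 (volume.restrict Ω) +
        sobolevConst * eLpNorm (gradient (η n)) 1 (volume.restrict Ω) := by
      gcongr
      exact (hη n).eLpNorm_le
    _ = eLpNorm (fun x => v x - η n x) 2 (volume.restrict Ω) +
        sobolevConst * eLpNorm (H - (fun x => H x - gradient (η n) x)) 1 (volume.restrict Ω) := by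
      congr 3; funext x; simp
    _ ≤ _ := by
      gcongr
      refine (eLpNorm_sub_le h.memLp_grad.1 hd.1 le_rfl).trans ?_
      gcongr
      exact eLpNorm_le_eLpNorm_mul_rpow_measure_univ (by norm_num) hd.1

/-- The Sobolev inequality for functions whose gradient is supported in a small set. -/
lemma HasH01Gradient.eLpNorm_le_of_support (hb : Bornology.IsBounded Ω)
    (h : HasH01Gradient Ω v H) {A : Set Plane} (hA : MeasurableSet A)
    (hH : ∀ x ∉ A, H x = 0) :
    eLpNorm v 2 (volume.restrict Ω) ≤ sobolevConst *
      (eLpNorm H 2 (volume.restrict Ω) * (volume.restrict Ω A) ^ (1 / 2 : ℝ)) := by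
  refine (h.eLpNorm_le hb).trans ?_
  gcongr
  have e : H = A.indicator H := by
    funext x
    by_cases hx : x ∈ A
    · simp [hx]
    · simp [hx, hH x hx]
  rw [e, eLpNorm_indicator_eq_eLpNorm_restrict hA, eLpNorm_indicator_eq_eLpNorm_restrict hA]
  refine (eLpNorm_le_eLpNorm_mul_rpow_measure_univ (q := 2) (by norm_num)
    h.memLp_grad.1.restrict).trans (le_of_eq ?_)
  rw [Measure.restrict_apply_univ]
  norm_num

end Sobolev

/-! ### Energy estimates on superlevel sets -/

/-- The norm of `L²(Ω; E)`, as a real number. -/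
noncomputable def l2Norm {E : Type*} [NormedAddCommGroup E] (Ω : Set Plane) (f : Plane → E) : ℝ :=
  (eLpNorm f 2 (volume.restrict Ω)).toReal

/-! ### Cauchy–Schwarz and Chebyshev for real-valued L² norms. -/

section L2Norm

variable {Ω : Set Plane} {E : Type*} [NormedAddCommGroup E]

lemma l2Norm_nonneg (f : Plane → E) : 0 ≤ l2Norm Ω f := ENNReal.toReal_nonneg

lemma l2Norm_norm (f : Plane → E) : l2Norm Ω (fun x => ‖f x‖) = l2Norm Ω f := by
  rw [l2Norm, eLpNorm_norm, l2Norm]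

lemma integral_mul_le_l2Norm {f g : Plane → ℝ} (hf : MemLp f 2 (volume.restrict Ω))
    (hg : MemLp g 2 (volume.restrict Ω)) :
    ∫ x in Ω, f x * g x ≤ l2Norm Ω f * l2Norm Ω g := by
  have := real_inner_le_norm (hf.toLp f) (hg.toLp g)
  rw [L2.inner_def, Lp.norm_toLp, Lp.norm_toLp] at this
  refine le_trans (le_of_eq (integral_congr_ae ?_)) this
  filter_upwards [hf.coeFn_toLp, hg.coeFn_toLp] with x h1 h2
  rw [h1, h2]
  simp [mul_comm]

lemma integral_norm_sq_eq_l2Norm {f : Plane → E} (hf : MemLp f 2 (volume.restrict Ω)) :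
    ∫ x in Ω, ‖f x‖ ^ 2 = l2Norm Ω f ^ 2 := by
  have h := hf.norm
  have := real_inner_self_eq_norm_sq (h.toLp _)
  rw [L2.inner_def, Lp.norm_toLp, eLpNorm_norm] at this
  refine Eq.trans (integral_congr_ae ?_) this
  filter_upwards [h.coeFn_toLp] with x h1
  rw [h1]
  simp [sq]

lemma l2Norm_indicator_one [IsFiniteMeasure (volume.restrict Ω)] {A : Set Plane}
    (hA : MeasurableSet A) :
    l2Norm Ω (A.indicator fun _ => (1 : ℝ)) = √((volume.restrict Ω).real A) := by
  rw [l2Norm, eLpNorm_indicator_const hA (by norm_num) (by norm_num), Real.sqrt_eq_rpow,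
    Measure.real]
  simp [ENNReal.toReal_rpow]

/-- Chebyshev's inequality. -/
lemma sq_mul_measureReal_le_l2Norm_sq [IsFiniteMeasure (volume.restrict Ω)] {f : Plane → ℝ}
    (hf : MemLp f 2 (volume.restrict Ω)) {A : Set Plane} (hA : MeasurableSet A) {h : ℝ}
    (hh : 0 ≤ h) (hle : ∀ x ∈ A, h ≤ f x) :
    h ^ 2 * (volume.restrict Ω).real A ≤ l2Norm Ω f ^ 2 := by
  rw [← integral_norm_sq_eq_l2Norm hf]
  have : h ^ 2 * (volume.restrict Ω).real A = ∫ x in Ω, A.indicator (fun _ => h ^ 2) x := by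
    rw [integral_indicator hA, setIntegral_const, smul_eq_mul, mul_comm]
  rw [this]
  refine integral_mono ((integrable_const _).indicator hA) hf.integrable_norm_pow' fun x => ?_
  by_cases hx : x ∈ A
  · simp only [Set.indicator_of_mem hx, Real.norm_eq_abs, sq_abs]
    exact pow_le_pow_left₀ hh (hle x hx) 2
  · rw [Set.indicator_of_notMem hx]
    positivity

end L2Norm

/-- `e` is an admissible constant in the Poincaré inequality on `H₀¹(Ω)`. -/
def PoincareBound (Ω : Set Plane) (e : ℝ) : Prop :=
  ∀ (v : Plane → ℝ) (H : Plane → Plane), HasH01Gradient Ω v H → l2Norm Ω v ≤ e * l2Norm Ω H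

/-- `u ∈ H₀¹(Ω)` solves `-Δu - ∇·F + W₂·∇u + f = 0` with `|F| ≤ w (1 + |u|)`, `|W₂| ≤ w₂`,
`|f| ≤ ν (1 + |u|)`, and the coefficients are small relative to the Poincaré constant. -/
structure IsSmallSolution (Ω : Set Plane) (e w w₂ ν : ℝ) (u : Plane → ℝ)
    (G F W₂ : Plane → Plane) (f : Plane → ℝ) : Prop where
  bounded : Bornology.IsBounded Ω
  hasGradient : HasH01Gradient Ω u G
  measurable : Measurable u
  e_pos : 0 < e
  poincare : PoincareBound Ω e
  w_nonneg : 0 ≤ w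
  w₂_nonneg : 0 ≤ w₂
  ν_nonneg : 0 ≤ ν
  memLp_F : MemLp F 2 (volume.restrict Ω)
  memLp_f : MemLp f 2 (volume.restrict Ω)
  aesm_W₂ : AEStronglyMeasurable W₂ (volume.restrict Ω)
  norm_F_le : ∀ᵐ x ∂volume.restrict Ω, ‖F x‖ ≤ w * (1 + |u x|)
  norm_W₂_le : ∀ᵐ x ∂volume.restrict Ω, ‖W₂ x‖ ≤ w₂
  abs_f_le : ∀ᵐ x ∂volume.restrict Ω, |f x| ≤ ν * (1 + |u x|)
  integral_eq : ∀ η, IsTestFunction Ω η →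
    ∫ x in Ω, (inner ℝ (G x + F x) (gradient η x) + (inner ℝ (W₂ x) (G x) + f x) * η x) = 0
  small : w * e + w₂ * e + ν * e ^ 2 ≤ 1 / 2

/-- The pointwise inequality behind the energy estimate. -/
lemma norm_sq_le_of_norm_le {E : Type*} [NormedAddCommGroup E] [InnerProductSpace ℝ E]
    {G H T F W : E} {v f w w₂ ν B N r : ℝ} (hG : G = H + T) (hv : 0 ≤ v) (hw : 0 ≤ w)
    (hw₂ : 0 ≤ w₂) (hν : 0 ≤ ν) (hT : ‖T‖ ≤ B) (hF : ‖F‖ ≤ w * r) (hW : ‖W‖ ≤ w₂)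
    (hf : |f| ≤ ν * r) (hr : r ≤ N + v) :
    ‖H‖ ^ 2 ≤ (inner ℝ (G + F) H + (inner ℝ W G + f) * v) +
      ((B + w * N) * ‖H‖ + (w + w₂) * (v * ‖H‖) + (w₂ * B + ν * N) * v + ν * (v * v)) := by
  have hH := norm_nonneg H
  have k1 : -(B * ‖H‖) ≤ inner ℝ T H :=
    (neg_le_neg (mul_le_mul_of_nonneg_right hT hH)).trans
      (abs_le.1 (abs_real_inner_le_norm T H)).1
  have k2 : -(w * (N + v) * ‖H‖) ≤ inner ℝ F H :=
    (neg_le_neg (mul_le_mul_of_nonneg_right (hF.trans (mul_le_mul_of_nonneg_left hr hw)) hH)).trans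
      (abs_le.1 (abs_real_inner_le_norm F H)).1
  have k3 : -(w₂ * (‖H‖ + B)) * v ≤ inner ℝ W G * v := by
    refine mul_le_mul_of_nonneg_right (le_trans (neg_le_neg ?_)
      (abs_le.1 (abs_real_inner_le_norm W G)).1) hv
    refine mul_le_mul hW ?_ (norm_nonneg _) hw₂
    rw [hG]
    exact (norm_add_le _ _).trans (by linarith)
  have k4 : -(ν * (N + v)) * v ≤ f * v :=
    mul_le_mul_of_nonneg_right ((neg_le_neg (hf.trans
      (mul_le_mul_of_nonneg_left hr hν))).trans (neg_le_of_abs_le le_rfl)) hv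
  have k5 : inner ℝ (G + F) H = ‖H‖ ^ 2 + inner ℝ T H + inner ℝ F H := by
    rw [inner_add_left, hG, inner_add_left, real_inner_self_eq_norm_sq]
  rw [k5]
  linarith

/-! ### Energy and level set estimates for small solutions. -/

namespace IsSmallSolution

variable {Ω : Set Plane} {e w w₂ ν : ℝ} {u : Plane → ℝ} {G F W₂ : Plane → Plane} {f : Plane → ℝ}

/-- The equation for φ − 1 is not odd, but the structure conditions see u only through |u|. Upper
bounds for u therefore give lower bounds too. -/
lemma neg (h : IsSmallSolution Ω e w w₂ ν u G F W₂ f) :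
    IsSmallSolution Ω e w w₂ ν (fun x => - u x) (fun x => - G x) (fun x => - F x) W₂
      (fun x => - f x) where
  bounded := h.bounded
  hasGradient := h.hasGradient.neg
  measurable := h.measurable.neg
  e_pos := h.e_pos
  poincare := h.poincare
  w_nonneg := h.w_nonneg
  w₂_nonneg := h.w₂_nonneg
  ν_nonneg := h.ν_nonneg
  memLp_F := h.memLp_F.neg
  memLp_f := h.memLp_f.neg
  aesm_W₂ := h.aesm_W₂
  norm_F_le := by simpa using h.norm_F_le
  norm_W₂_le := h.norm_W₂_le
  abs_f_le := by simpa using h.abs_f_le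
  integral_eq η hη := by
    rw [← neg_eq_zero, ← integral_neg, ← h.integral_eq η hη]
    refine integral_congr_ae (.of_forall fun x => ?_)
    simp only [← neg_add, inner_neg_left, inner_neg_right]
    ring
  small := h.small

lemma isFiniteMeasure (h : IsSmallSolution Ω e w w₂ ν u G F W₂ f) :
    IsFiniteMeasure (volume.restrict Ω) :=
  isFiniteMeasure_restrict.2 h.bounded.measure_lt_top.ne

/-- Testing the equation with an element of `H₀¹`. -/
lemma integral_eq_zero (h : IsSmallSolution Ω e w w₂ ν u G F W₂ f) {v : Plane → ℝ}
    {H : Plane → Plane} (hv : HasH01Gradient Ω v H) :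
    ∫ x in Ω, (inner ℝ (G x + F x) (H x) + (inner ℝ (W₂ x) (G x) + f x) * v x) = 0 ∧
    Integrable (fun x => inner ℝ (G x + F x) (H x) + (inner ℝ (W₂ x) (G x) + f x) * v x)
      (volume.restrict Ω) := by
  have hP : MemLp (fun x => G x + F x) 2 (volume.restrict Ω) :=
    h.hasGradient.memLp_grad.add h.memLp_F
  have hQ1 : MemLp (fun x => inner ℝ (W₂ x) (G x)) 2 (volume.restrict Ω) := by
    refine h.hasGradient.memLp_grad.of_le_mul (c := w₂)
      (h.aesm_W₂.inner h.hasGradient.memLp_grad.1) ?_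
    filter_upwards [h.norm_W₂_le] with x hx
    exact (norm_inner_le_norm _ _).trans (mul_le_mul_of_nonneg_right hx (norm_nonneg _))
  have hQ : MemLp (fun x => inner ℝ (W₂ x) (G x) + f x) 2 (volume.restrict Ω) :=
    hQ1.add h.memLp_f
  exact ⟨hv.integral_eq_zero hP hQ h.integral_eq,
    (integrable_inner_of_memLp hP hv.memLp_grad).add (hQ.integrable_mul hv.memLp)⟩

/-- The energy estimate on a superlevel set. -/
lemma l2Norm_gradient_le (h : IsSmallSolution Ω e w w₂ ν u G F W₂ f) {θ : Plane → ℝ}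
    (hθ : ContDiff ℝ ∞ θ) (hθ0 : ∀ x, 0 ≤ θ x) {B N : ℝ} (hB : 0 ≤ B) (hN : 0 ≤ N)
    (hgrad : ∀ᵐ x ∂volume.restrict Ω, θ x < u x → ‖gradient θ x‖ ≤ B)
    (hu : ∀ᵐ x ∂volume.restrict Ω, θ x < u x → 1 + |u x| ≤ N + (u x - θ x)) :
    l2Norm Ω ({x | θ x < u x}.indicator fun x => G x - gradient θ x) ≤
      2 * (2 * B + (w + ν * e) * N) * √((volume.restrict Ω).real {x | θ x < u x}) := by
  have := h.isFiniteMeasure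
  have hv := h.hasGradient.posPart_sub h.bounded h.measurable hθ hθ0
  have hA : MeasurableSet {x | θ x < u x} :=
    measurableSet_lt hθ.continuous.measurable h.measurable
  obtain ⟨hint, hintg⟩ := h.integral_eq_zero hv
  set A := {x | θ x < u x} with hAdef
  set v : Plane → ℝ := fun x => max (u x - θ x) 0 with hvdef
  set H : Plane → Plane := A.indicator fun x => G x - gradient θ x with hHdef
  set χ : Plane → ℝ := A.indicator fun _ => 1 with hχdef
  set a := √((volume.restrict Ω).real A) with hadef
  have hχm : MemLp χ 2 (volume.restrict Ω) := (memLp_const 1).indicator hA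
  have hχn : l2Norm Ω χ = a := l2Norm_indicator_one hA
  have hw := h.w_nonneg
  have hw₂ := h.w₂_nonneg
  have hν := h.ν_nonneg
  have he := h.e_pos
  have hHm := hv.memLp_grad
  have hvm := hv.memLp
  have i1 : Integrable (fun x => χ x * ‖H x‖) (volume.restrict Ω) := hχm.integrable_mul hHm.norm
  have i2 : Integrable (fun x => v x * ‖H x‖) (volume.restrict Ω) := hvm.integrable_mul hHm.norm
  have i3 : Integrable (fun x => χ x * v x) (volume.restrict Ω) := hχm.integrable_mul hvm
  have i4 : Integrable (fun x => v x * v x) (volume.restrict Ω) := hvm.integrable_mul hvm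
  set g := l2Norm Ω H with hgdef
  have hg : 0 ≤ g := l2Norm_nonneg _
  have ha : 0 ≤ a := Real.sqrt_nonneg _
  have hpo : l2Norm Ω v ≤ e * g := h.poincare v H hv
  have hvn : 0 ≤ l2Norm Ω v := l2Norm_nonneg _
  have b1 : ∫ x in Ω, χ x * ‖H x‖ ≤ a * g := by
    have := integral_mul_le_l2Norm hχm hHm.norm
    rwa [hχn, l2Norm_norm] at this
  have b2 : ∫ x in Ω, v x * ‖H x‖ ≤ e * g * g := by
    have := integral_mul_le_l2Norm hvm hHm.norm
    rw [l2Norm_norm] at this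
    exact this.trans (mul_le_mul_of_nonneg_right hpo hg)
  have b3 : ∫ x in Ω, χ x * v x ≤ a * (e * g) := by
    have := integral_mul_le_l2Norm hχm hvm
    rw [hχn] at this
    exact this.trans (mul_le_mul_of_nonneg_left hpo ha)
  have b4 : ∫ x in Ω, v x * v x ≤ (e * g) * (e * g) :=
    (integral_mul_le_l2Norm hvm hvm).trans (mul_le_mul hpo hpo hvn (by positivity))
  have hpt : ∀ᵐ x ∂volume.restrict Ω, ‖H x‖ ^ 2 ≤
      (inner ℝ (G x + F x) (H x) + (inner ℝ (W₂ x) (G x) + f x) * v x) +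
      ((B + w * N) * (χ x * ‖H x‖) + (w + w₂) * (v x * ‖H x‖) + (w₂ * B + ν * N) * (χ x * v x)
        + ν * (v x * v x)) := by
    filter_upwards [hgrad, hu, h.norm_F_le, h.norm_W₂_le, h.abs_f_le] with x h1 h2 h3 h4 h5
    by_cases hx : θ x < u x
    · have hxA : x ∈ A := hx
      have hH : H x = G x - gradient θ x := Set.indicator_of_mem hxA _
      have hχ : χ x = 1 := Set.indicator_of_mem hxA _
      have hvx : v x = u x - θ x := max_eq_left (sub_nonneg.2 hx.le)
      have hv0 : 0 ≤ v x := le_max_right _ _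
      have hGx : G x = H x + gradient θ x := by rw [hH]; abel
      have := norm_sq_le_of_norm_le hGx hv0 hw hw₂ hν (h1 hx) h3 h4 h5 (hvx ▸ h2 hx)
      rwa [hχ, one_mul, one_mul]
    · have hxA : x ∉ A := hx
      have hH : H x = 0 := Set.indicator_of_notMem hxA _
      have hvx : v x = 0 := max_eq_right (sub_nonpos.2 (not_lt.1 hx))
      simp [hH, hvx]
  have j2 : Integrable (fun x => (B + w * N) * (χ x * ‖H x‖) + (w + w₂) * (v x * ‖H x‖))
      (volume.restrict Ω) := (i1.const_mul _).add (i2.const_mul _)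
  have j3 : Integrable (fun x => (B + w * N) * (χ x * ‖H x‖) + (w + w₂) * (v x * ‖H x‖) +
      (w₂ * B + ν * N) * (χ x * v x)) (volume.restrict Ω) := j2.add (i3.const_mul _)
  have hR : Integrable (fun x => (B + w * N) * (χ x * ‖H x‖) + (w + w₂) * (v x * ‖H x‖) +
      (w₂ * B + ν * N) * (χ x * v x) + ν * (v x * v x)) (volume.restrict Ω) :=
    j3.add (i4.const_mul _)
  have hmain := integral_mono_ae hHm.integrable_norm_pow' (hintg.add hR) hpt
  rw [integral_norm_sq_eq_l2Norm hHm, integral_add' hintg hR, hint, zero_add,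
    integral_add j3 (i4.const_mul _), integral_add j2 (i3.const_mul _),
    integral_add (i1.const_mul _) (i2.const_mul _), integral_const_mul, integral_const_mul,
    integral_const_mul, integral_const_mul] at hmain
  have hmain2 : g ^ 2 ≤ (B + w * N) * (a * g) + (w + w₂) * (e * g * g) +
      (w₂ * B + ν * N) * (a * (e * g)) + ν * ((e * g) * (e * g)) := by
    refine hmain.trans ?_
    gcongr
  have hs := h.small
  have hs2 : w₂ * e ≤ 1 := by nlinarith [mul_nonneg hw he.le, mul_nonneg hν (sq_nonneg e)]
  -- The terms quadratic in g sum to at most g²/2 by `small` and are absorbed. In the linear ones,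
  -- w₂ e ≤ 1 bounds w₂ B e by B, whence the 2B.
  have h6 : g ^ 2 / 2 ≤ (2 * B + (w + ν * e) * N) * a * g := by
    have q1 : (w * e + w₂ * e + ν * e ^ 2) * g ^ 2 ≤ 1 / 2 * g ^ 2 :=
      mul_le_mul_of_nonneg_right hs (sq_nonneg g)
    have q2 : w₂ * e * (B * (a * g)) ≤ 1 * (B * (a * g)) :=
      mul_le_mul_of_nonneg_right hs2 (by positivity)
    nlinarith
  rcases hg.eq_or_lt with h0 | h0
  · rw [← h0]
    positivity
  · have : g * g ≤ (2 * (2 * B + (w + ν * e) * N) * a) * g := by nlinarith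
    exact le_of_mul_le_mul_right this h0

/-- The level set estimates coming from the Poincaré and the Sobolev inequality. -/
lemma sq_mul_measureReal_le (h : IsSmallSolution Ω e w w₂ ν u G F W₂ f) {θ : Plane → ℝ}
    (hθ : ContDiff ℝ ∞ θ) (hθ0 : ∀ x, 0 ≤ θ x) {B N : ℝ} (hB : 0 ≤ B) (hN : 0 ≤ N)
    (hgrad : ∀ᵐ x ∂volume.restrict Ω, θ x < u x → ‖gradient θ x‖ ≤ B)
    (hu : ∀ᵐ x ∂volume.restrict Ω, θ x < u x → 1 + |u x| ≤ N + (u x - θ x))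
    {t : ℝ} (ht : 0 ≤ t) :
    t ^ 2 * (volume.restrict Ω).real {x | θ x + t < u x} ≤
      4 * e ^ 2 * (2 * B + (w + ν * e) * N) ^ 2 * (volume.restrict Ω).real {x | θ x < u x} ∧
    t ^ 2 * (volume.restrict Ω).real {x | θ x + t < u x} ≤
      4 * (sobolevConst : ℝ) ^ 2 * (2 * B + (w + ν * e) * N) ^ 2 *
        (volume.restrict Ω).real {x | θ x < u x} ^ 2 := by
  have := h.isFiniteMeasure
  have hv := h.hasGradient.posPart_sub h.bounded h.measurable hθ hθ0
  have hA : MeasurableSet {x | θ x < u x} :=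
    measurableSet_lt hθ.continuous.measurable h.measurable
  have hA' : MeasurableSet {x | θ x + t < u x} :=
    measurableSet_lt (hθ.continuous.measurable.add_const t) h.measurable
  have hg := h.l2Norm_gradient_le hθ hθ0 hB hN hgrad hu
  have hch := sq_mul_measureReal_le_l2Norm_sq hv.memLp hA' ht fun x hx =>
    le_max_of_le_left (by linarith [show θ x + t < u x from hx])
  set m := (volume.restrict Ω).real {x | θ x < u x}
  have hm : 0 ≤ m := measureReal_nonneg
  have hgsq := pow_le_pow_left₀ (l2Norm_nonneg _) hg 2
  rw [mul_pow, Real.sq_sqrt hm] at hgsq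
  have hvn := l2Norm_nonneg (Ω := Ω) fun x => max (u x - θ x) 0
  refine ⟨hch.trans ?_, hch.trans ?_⟩
  · have h1 := pow_le_pow_left₀ hvn (h.poincare _ _ hv) 2
    rw [mul_pow] at h1
    nlinarith [mul_le_mul_of_nonneg_left hgsq (sq_nonneg e)]
  -- The gradient lives on {u > θ}, so Cauchy–Schwarz in the L¹ Sobolev inequality gains a further
  -- √m; the bound becomes quadratic in m.
  · have h0 := hv.eLpNorm_le_of_support h.bounded hA fun x hx => Set.indicator_of_notMem hx _
    have h1 : l2Norm Ω (fun x => max (u x - θ x) 0) ≤ sobolevConst *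
        (l2Norm Ω ({x | θ x < u x}.indicator fun x => G x - gradient θ x) * √m) := by
      have := ENNReal.toReal_mono (by
        refine ENNReal.mul_ne_top ENNReal.coe_ne_top (ENNReal.mul_ne_top hv.memLp_grad.2.ne
          (ENNReal.rpow_ne_top_of_nonneg (by norm_num) (measure_ne_top _ _)))) h0
      rwa [ENNReal.toReal_mul, ENNReal.toReal_mul, ← ENNReal.toReal_rpow, ← Real.sqrt_eq_rpow,
        ENNReal.coe_toReal] at this
    have h2 := pow_le_pow_left₀ hvn h1 2
    rw [mul_pow, mul_pow, Real.sq_sqrt hm] at h2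
    refine h2.trans ?_
    have h3 := mul_le_mul_of_nonneg_left (mul_le_mul_of_nonneg_right hgsq hm)
      (sq_nonneg (sobolevConst : ℝ))
    refine h3.trans (le_of_eq ?_)
    ring

end IsSmallSolution

/-- De Giorgi's iteration lemma. -/
lemma eq_zero_of_sq_mul_le {m : ℝ → ℝ} (hm0 : ∀ k, 0 ≤ m k) {k₀ d K : ℝ} (hd : 0 < d)
    (hK : 0 ≤ K) (hanti : ∀ k l, k ≤ l → m l ≤ m k)
    (hm : ∀ k t, k₀ ≤ k → 0 < t → k + t ≤ k₀ + d → t ^ 2 * m (k + t) ≤ K * m k ^ 2)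
    (hsmall : 16 * K * m k₀ ≤ d ^ 2) : m (k₀ + d) = 0 := by
  -- The n-th increment is d/2^(n+1). With decay rate 1/4, the quadratic recursion closes exactly
  -- when 16 K m(k₀) ≤ d².
  have key : ∀ n : ℕ, m (k₀ + d * (1 - (1 / 2) ^ n)) ≤ m k₀ * (1 / 4) ^ n := by
    intro n
    induction n with
    | zero => simp
    | succ n ih =>
      have hp : (0 : ℝ) < (1 / 2) ^ n := by positivity
      have hp1 : ((1 : ℝ) / 2) ^ n ≤ 1 := pow_le_one₀ (by norm_num) (by norm_num)
      have h4 : ((1 : ℝ) / 4) ^ n = (1 / 2) ^ n * (1 / 2) ^ n := by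
        rw [← mul_pow]; norm_num
      have h1 := hm (k₀ + d * (1 - (1 / 2) ^ n)) (d * ((1 / 2) ^ n / 2))
        (by nlinarith) (by positivity) (by nlinarith)
      have e1 : k₀ + d * (1 - (1 / 2) ^ n) + d * ((1 / 2) ^ n / 2) =
          k₀ + d * (1 - (1 / 2) ^ (n + 1)) := by rw [pow_succ]; ring
      rw [e1] at h1
      rw [pow_succ (1 / 4 : ℝ), h4]
      rw [h4] at ih
      set p := ((1 : ℝ) / 2) ^ n
      have h2 := pow_le_pow_left₀ (hm0 _) ih 2
      have h3 : K * m (k₀ + d * (1 - p)) ^ 2 ≤ K * (m k₀ * (p * p)) ^ 2 :=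
        mul_le_mul_of_nonneg_left h2 hK
      have h5 : 16 * K * m k₀ * (m k₀ * p ^ 4) ≤ d ^ 2 * (m k₀ * p ^ 4) :=
        mul_le_mul_of_nonneg_right hsmall (mul_nonneg (hm0 _) (by positivity))
      have h6 : (d * (p / 2)) ^ 2 * m (k₀ + d * (1 - (1 / 2) ^ (n + 1))) ≤
          (d * (p / 2)) ^ 2 * (m k₀ * (p * p * (1 / 4))) := by nlinarith
      exact le_of_mul_le_mul_left h6 (by positivity)
  have hle : ∀ n : ℕ, m (k₀ + d) ≤ m k₀ * (1 / 4) ^ n := fun n =>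
    (hanti _ _ (by
      have : (0 : ℝ) < (1 / 2) ^ n := by positivity
      nlinarith)).trans (key n)
  have hlim : Tendsto (fun n : ℕ => m k₀ * (1 / 4 : ℝ) ^ n) atTop (𝓝 (m k₀ * 0)) :=
    (tendsto_pow_atTop_nhds_zero_of_lt_one (by norm_num) (by norm_num)).const_mul _
  rw [mul_zero] at hlim
  exact le_antisymm (ge_of_tendsto' hlim hle) (hm0 _)

/-! ### Supremum bounds -/

lemma gradient_add_const (f : Plane → ℝ) (k : ℝ) (x : Plane) :
    gradient (fun y => f y + k) x = gradient f x := by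
  simp only [gradient_eq_toDual_symm_fderiv, fderiv_add_const]

lemma contDiff_mul_norm_sub_sq (a k : ℝ) (x₀ : Plane) :
    ContDiff ℝ ∞ (fun x : Plane => a * ‖x - x₀‖ ^ 2 + k) :=
  (contDiff_const.mul ((contDiff_id.sub contDiff_const).norm_sq ℝ)).add contDiff_const

lemma norm_gradient_mul_norm_sub_sq {a : ℝ} (ha : 0 ≤ a) (k : ℝ) (x₀ x : Plane) :
    ‖gradient (fun x : Plane => a * ‖x - x₀‖ ^ 2 + k) x‖ ≤ 2 * a * ‖x - x₀‖ := by
  rw [gradient_add_const, norm_gradient]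
  have h := (((hasStrictFDerivAt_norm_sq (x - x₀)).hasFDerivAt.comp x
    ((hasFDerivAt_id x).sub_const x₀)).const_mul a)
  have h2 : fderiv ℝ (fun x : Plane => a * ‖x - x₀‖ ^ 2) x = _ := h.fderiv
  have h3 : ‖(2 : ℕ) • innerSL ℝ (x - x₀)‖ ≤ 2 * ‖x - x₀‖ := by
    refine norm_nsmul_le.trans ?_
    rw [innerSL_apply_norm, Nat.cast_ofNat]
  rw [h2, ContinuousLinearMap.comp_id, norm_smul, Real.norm_of_nonneg ha]
  linarith [mul_le_mul_of_nonneg_left h3 ha]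

namespace IsSmallSolution

variable {Ω : Set Plane} {e w w₂ ν : ℝ} {u : Plane → ℝ} {G F W₂ : Plane → Plane} {f : Plane → ℝ}

/-- De Giorgi's iteration with constant levels. The bound is not scale invariant; it only serves to
make ‖u‖_∞ finite, so that it can be absorbed later. -/
lemma exists_ae_le (h : IsSmallSolution Ω e w w₂ ν u G F W₂ f) :
    ∃ M : ℝ, ∀ᵐ x ∂volume.restrict Ω, u x ≤ M := by
  have := h.isFiniteMeasure
  set q := w + ν * e with hq
  have hq0 : 0 ≤ q := add_nonneg h.w_nonneg (mul_nonneg h.ν_nonneg h.e_pos.le)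
  set S := (sobolevConst : ℝ)
  have hS : 0 ≤ S := NNReal.coe_nonneg _
  set b := l2Norm Ω u
  have hb : 0 ≤ b := l2Norm_nonneg _
  -- Chebyshev gives m(k₀) ≤ b²/k₀², so this k₀ makes 256 S² q² m(k₀) ≤ 1.
  set k₀ := 16 * S * q * b + 1 with hk₀
  have hk₀1 : 1 ≤ k₀ := by
    have : 0 ≤ 16 * S * q * b := by positivity
    linarith
  set m : ℝ → ℝ := fun k => (volume.restrict Ω).real {x | k < u x} with hm
  have hm0 : ∀ k, 0 ≤ m k := fun k => measureReal_nonneg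
  have hch : k₀ ^ 2 * m k₀ ≤ b ^ 2 :=
    sq_mul_measureReal_le_l2Norm_sq h.hasGradient.memLp
      (measurableSet_lt measurable_const h.measurable) (by linarith) fun x hx => le_of_lt hx
  have hsm : 256 * S ^ 2 * q ^ 2 * m k₀ ≤ 1 := by
    have h1 : (16 * S * q * b) ^ 2 ≤ k₀ ^ 2 :=
      pow_le_pow_left₀ (by positivity) (by linarith) 2
    have h2 : k₀ ^ 2 * (256 * S ^ 2 * q ^ 2 * m k₀) ≤ k₀ ^ 2 * 1 := by
      have := mul_le_mul_of_nonneg_left hch (show 0 ≤ 256 * S ^ 2 * q ^ 2 by positivity)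
      nlinarith
    exact le_of_mul_le_mul_left h2 (by positivity)
  have hz : m (k₀ + (1 + k₀)) = 0 := by
    -- For levels k ≤ 2k₀ + 1 and u > k one has 1 + |u| = 1 + k + (u − k), so N = 2(1 + k₀) works.
    -- As K scales like (1 + k₀)², the increment 1 + k₀ cancels it in the smallness condition.
    refine eq_zero_of_sq_mul_le hm0 (K := 4 * S ^ 2 * (2 * 0 + q * (2 * (1 + k₀))) ^ 2)
      (by linarith) (by positivity) (fun k l hkl => measureReal_mono fun x hx =>
        lt_of_le_of_lt hkl hx) (fun k t hk ht hkt => ?_) ?_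
    · have hkn : 0 ≤ k := by linarith
      refine (h.sq_mul_measureReal_le (θ := fun _ => k) contDiff_const (fun _ => hkn) (B := 0)
        (N := 2 * (1 + k₀)) le_rfl (by linarith) (.of_forall fun x _ => ?_)
        (.of_forall fun x hx => ?_) ht.le).2
      · rw [gradient_fun_const, norm_zero]
      · rw [abs_of_pos (lt_of_le_of_lt hkn hx)]
        linarith
    · have := mul_le_mul_of_nonneg_right hsm (sq_nonneg (1 + k₀))
      linarith
  refine ⟨k₀ + (1 + k₀), ?_⟩
  rw [hm] at hz
  rw [measureReal_eq_zero_iff] at hz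
  filter_upwards [measure_eq_zero_iff_ae_notMem.1 hz] with x hx
  exact not_lt.1 hx

/-- Comparison with a paraboloid barrier. -/
lemma ae_le_barrier (h : IsSmallSolution Ω e w w₂ ν u G F W₂ f) {M R k₀ : ℝ} (hM : 0 ≤ M)
    (hu : ∀ᵐ x ∂volume.restrict Ω, |u x| ≤ M) (hR : 0 < R) (hk₀ : 0 < k₀)
    (hk : 256 * (sobolevConst : ℝ) ^ 2 * volume.real (Metric.ball (0 : Plane) 1) * e ^ 2 * R ^ 2 *
      (4 * M / R + (w + ν * e) * (1 + M)) ^ 4 ≤ k₀ ^ 4) (x₀ : Plane) :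
    ∀ᵐ x ∂volume.restrict Ω, u x ≤ M / R ^ 2 * ‖x - x₀‖ ^ 2 + 2 * k₀ := by
  have := h.isFiniteMeasure
  set q := w + ν * e with hq
  have hq0 : 0 ≤ q := add_nonneg h.w_nonneg (mul_nonneg h.ν_nonneg h.e_pos.le)
  set S := (sobolevConst : ℝ)
  set σ := volume.real (Metric.ball (0 : Plane) 1)
  have hσ : 0 ≤ σ := measureReal_nonneg
  set g := 2 * (2 * M / R) + q * (1 + M) with hg
  have hg' : 4 * M / R + q * (1 + M) = g := by rw [hg]; ring
  rw [hg'] at hk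
  have hg0 : 0 ≤ g := by positivity
  have ha : 0 ≤ M / R ^ 2 := by positivity
  -- Outside the ball of radius R about x₀ the barrier is at least M ≥ u. Its superlevel sets thus
  -- have measure at most σR², whatever the size of Ω, and there its slope is at most 2M/R.
  set θ : ℝ → Plane → ℝ := fun k x => M / R ^ 2 * ‖x - x₀‖ ^ 2 + k with hθ
  set m : ℝ → ℝ := fun k => (volume.restrict Ω).real {x | θ k x < u x} with hm
  have hm0 : ∀ k, 0 ≤ m k := fun k => measureReal_nonneg
  have hball : ∀ k, 0 ≤ k → ∀ᵐ x ∂volume.restrict Ω, θ k x < u x → ‖x - x₀‖ < R := by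
    intro k hkn
    filter_upwards [hu] with x hx hlt
    have h1 : M / R ^ 2 * ‖x - x₀‖ ^ 2 < M := by
      have : M / R ^ 2 * ‖x - x₀‖ ^ 2 + k < u x := hlt
      linarith [le_abs_self (u x)]
    by_contra hcon
    have h2 : R ^ 2 ≤ ‖x - x₀‖ ^ 2 := pow_le_pow_left₀ hR.le (not_lt.1 hcon) 2
    have h3 : M / R ^ 2 * R ^ 2 ≤ M / R ^ 2 * ‖x - x₀‖ ^ 2 := mul_le_mul_of_nonneg_left h2 ha
    rw [div_mul_cancel₀ _ (by positivity)] at h3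
    linarith
  have hlev : ∀ k t, 0 ≤ k → 0 ≤ t →
      t ^ 2 * m (k + t) ≤ 4 * e ^ 2 * g ^ 2 * m k ∧ t ^ 2 * m (k + t) ≤
        4 * S ^ 2 * g ^ 2 * m k ^ 2 := by
    intro k t hkn ht
    have := h.sq_mul_measureReal_le (θ := θ k) (contDiff_mul_norm_sub_sq _ _ _)
      (fun x => by positivity) (B := 2 * M / R) (N := 1 + M) (by positivity) (by positivity)
      (by
        filter_upwards [hball k hkn] with x hx hlt
        refine (norm_gradient_mul_norm_sub_sq ha k x₀ x).trans ?_
        have h1 : 2 * (M / R ^ 2) * ‖x - x₀‖ ≤ 2 * (M / R ^ 2) * R :=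
          mul_le_mul_of_nonneg_left (hx hlt).le (by positivity)
        refine h1.trans (le_of_eq ?_)
        field_simp)
      (by
        filter_upwards [hu] with x hx hlt
        linarith) ht
    have hset : {x | θ k x + t < u x} = {x | θ (k + t) x < u x} := by
      ext x
      simp only [hθ, Set.mem_ofPred_eq, add_assoc]
    rwa [hset] at this
  have hm00 : m 0 ≤ σ * R ^ 2 := by
    have h1 : (volume.restrict Ω) {x | θ 0 x < u x} ≤ volume (Metric.ball x₀ R) := by
      refine (measure_mono_ae ?_).trans (Measure.restrict_apply_le _ _)
      filter_upwards [hball 0 le_rfl] with x hx hlt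
      exact mem_ball_iff_norm.2 (hx hlt)
    have h2 := ENNReal.toReal_mono measure_ball_lt_top.ne h1
    rw [Measure.addHaar_ball _ _ hR.le, finrank_euclideanSpace_fin, ENNReal.toReal_mul,
      ENNReal.toReal_ofReal (by positivity), mul_comm] at h2
    exact h2
  have hz : m (k₀ + k₀) = 0 := by
    refine eq_zero_of_sq_mul_le hm0 (K := 4 * S ^ 2 * g ^ 2) hk₀ (by positivity)
      (fun k l hkl => measureReal_mono fun x hx => ?_)
      (fun k t hk ht hkt => (hlev k t (by linarith) ht.le).2) ?_
    · have h1 : M / R ^ 2 * ‖x - x₀‖ ^ 2 + l < u x := hx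
      change M / R ^ 2 * ‖x - x₀‖ ^ 2 + k < u x
      linarith
    -- The first rise by k₀ uses the Poincaré estimate, giving k₀² m(k₀) ≤ 4e²g²σR². Hypothesis `hk`
    -- is precisely what De Giorgi's smallness condition then requires for the second rise.
    · have h1 := (hlev 0 k₀ le_rfl hk₀.le).1
      rw [zero_add] at h1
      have h2 : 4 * e ^ 2 * g ^ 2 * m 0 ≤ 4 * e ^ 2 * g ^ 2 * (σ * R ^ 2) :=
        mul_le_mul_of_nonneg_left hm00 (by positivity)
      have h3 := mul_le_mul_of_nonneg_left (h1.trans h2) (show 0 ≤ 64 * S ^ 2 * g ^ 2 by positivity)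
      have h4 : k₀ ^ 2 * (16 * (4 * S ^ 2 * g ^ 2) * m k₀) ≤ k₀ ^ 2 * k₀ ^ 2 := by
        calc _ = 64 * S ^ 2 * g ^ 2 * (k₀ ^ 2 * m k₀) := by ring
          _ ≤ _ := h3
          _ = 256 * S ^ 2 * σ * e ^ 2 * R ^ 2 * g ^ 4 := by ring
          _ ≤ k₀ ^ 4 := hk
          _ = _ := by ring
      exact le_of_mul_le_mul_left h4 (by positivity)
  rw [hm] at hz
  rw [measureReal_eq_zero_iff] at hz
  filter_upwards [measure_eq_zero_iff_ae_notMem.1 hz] with x hx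
  have := not_lt.1 hx
  rw [two_mul]
  exact this

/-- An auxiliary constant for the supremum bound, depending only on the dimension. -/
noncomputable def _root_.barrierConst : ℝ :=
  256 * (sobolevConst : ℝ) ^ 2 * volume.real (Metric.ball (0 : Plane) 1) + 1

lemma _root_.one_le_barrierConst : 1 ≤ barrierConst := by
  have : 0 ≤ 256 * (sobolevConst : ℝ) ^ 2 * volume.real (Metric.ball (0 : Plane) 1) := by
    have : 0 ≤ volume.real (Metric.ball (0 : Plane) 1) := measureReal_nonneg
    positivity
  rw [barrierConst]
  linarith

/-- Within R/2 of its centre the paraboloid contributes only M/4, and for R a large multiple of e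
its slope costs another M/4. Every point is close to the centre of some barrier. -/
lemma ae_le_of_abs_le (h : IsSmallSolution Ω e w w₂ ν u G F W₂ f) {M δ : ℝ} (hM : 0 ≤ M)
    (hu : ∀ᵐ x ∂volume.restrict Ω, |u x| ≤ M) (hδ : 0 < δ) :
    ∀ᵐ x ∂volume.restrict Ω,
      u x ≤ M / 2 + 64 * barrierConst ^ 2 * e * (w + ν * e) * (1 + M) + δ := by
  have he := h.e_pos
  set q := w + ν * e with hq
  have hq0 : 0 ≤ q := add_nonneg h.w_nonneg (mul_nonneg h.ν_nonneg h.e_pos.le)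
  have hc1 := one_le_barrierConst
  set c := barrierConst with hc
  have hc0 : 0 < c := by linarith
  -- Chosen so that the slope term 64 c² e · 4M/R equals M/4.
  set R := 1024 * c ^ 2 * e with hRdef
  have hR : 0 < R := by positivity
  set g := 4 * M / R + q * (1 + M) with hg
  have hg0 : 0 ≤ g := by positivity
  -- The factor 32 comes from 1024² = 32⁴ in e²R²g⁴; δ keeps k₀ positive even when g = 0.
  set k₀ := 32 * c ^ 2 * e * g + δ / 2 with hk₀
  have hk₀0 : 0 < k₀ := by positivity
  have hkey : 256 * (sobolevConst : ℝ) ^ 2 * volume.real (Metric.ball (0 : Plane) 1) * e ^ 2 *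
      R ^ 2 * g ^ 4 ≤ k₀ ^ 4 := by
    have h1 : 256 * (sobolevConst : ℝ) ^ 2 * volume.real (Metric.ball (0 : Plane) 1) ≤ c ^ 4 := by
      have h2 : c ≤ c ^ 4 := le_self_pow₀ hc1 (by norm_num)
      refine le_trans ?_ h2
      rw [hc, barrierConst]
      linarith
    calc _ ≤ c ^ 4 * e ^ 2 * R ^ 2 * g ^ 4 := by gcongr
      _ = (32 * c ^ 2 * e * g) ^ 4 := by rw [hRdef]; ring
      _ ≤ k₀ ^ 4 := pow_le_pow_left₀ (by positivity) (by linarith) 4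
  -- The exceptional null set depends on the centre, so only countably many centres, from a dense
  -- sequence, are used.
  have hall : ∀ᵐ x ∂volume.restrict Ω, ∀ n : ℕ,
      u x ≤ M / R ^ 2 * ‖x - TopologicalSpace.denseSeq Plane n‖ ^ 2 + 2 * k₀ :=
    ae_all_iff.2 fun n => h.ae_le_barrier hM hu hR hk₀0 hkey _
  filter_upwards [hall] with x hx
  obtain ⟨n, hn⟩ := (TopologicalSpace.denseRange_denseSeq Plane).exists_dist_lt x
    (show 0 < R / 2 by positivity)
  refine (hx n).trans ?_
  rw [dist_eq_norm] at hn
  have h1 : ‖x - TopologicalSpace.denseSeq Plane n‖ ^ 2 ≤ (R / 2) ^ 2 :=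
    pow_le_pow_left₀ (norm_nonneg _) hn.le 2
  have h2 := mul_le_mul_of_nonneg_left h1 (show 0 ≤ M / R ^ 2 by positivity)
  have h3 : M / R ^ 2 * (R / 2) ^ 2 = M / 4 := by field_simp; norm_num
  have h4 : 64 * c ^ 2 * e * (4 * M / R) = M / 4 := by rw [hRdef]; field_simp; ring
  have h5 : 2 * k₀ = M / 4 + 64 * c ^ 2 * e * q * (1 + M) + δ := by
    rw [hk₀, hg, ← h4]; ring
  linarith

/-- The scale invariant supremum bound. -/
theorem eLpNorm_top_le (h : IsSmallSolution Ω e w w₂ ν u G F W₂ f)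
    (hq : 256 * barrierConst ^ 2 * e * (w + ν * e) ≤ 1) :
    eLpNorm u ∞ (volume.restrict Ω) ≤
      ENNReal.ofReal (256 * barrierConst ^ 2 * e * (w + ν * e)) := by
  obtain ⟨M₁, hM₁⟩ := h.exists_ae_le
  obtain ⟨M₂, hM₂⟩ := h.neg.exists_ae_le
  have hbd : eLpNorm u ∞ (volume.restrict Ω) ≤ ENNReal.ofReal (max M₁ M₂) := by
    refine eLpNormEssSup_le_of_ae_bound (C := max M₁ M₂) ?_
    filter_upwards [hM₁, hM₂] with x h1 h2
    rw [Real.norm_eq_abs, abs_le]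
    constructor
    · linarith [le_max_right M₁ M₂]
    · linarith [le_max_left M₁ M₂]
  have hfin : eLpNorm u ∞ (volume.restrict Ω) ≠ ⊤ := (hbd.trans_lt ENNReal.ofReal_lt_top).ne
  set M := (eLpNorm u ∞ (volume.restrict Ω)).toReal with hM
  have hM0 : 0 ≤ M := ENNReal.toReal_nonneg
  have hMeq : eLpNorm u ∞ (volume.restrict Ω) = ENNReal.ofReal M :=
    (ENNReal.ofReal_toReal hfin).symm
  have hu : ∀ᵐ x ∂volume.restrict Ω, |u x| ≤ M := by
    filter_upwards [enorm_ae_le_eLpNormEssSup u (volume.restrict Ω)] with x hx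
    rw [← eLpNorm_exponent_top, hMeq, ← ofReal_norm] at hx
    exact (ENNReal.ofReal_le_ofReal_iff hM0).1 hx
  have hu' : ∀ᵐ x ∂volume.restrict Ω, |-u x| ≤ M := by simpa using hu
  set D := 64 * barrierConst ^ 2 * e * (w + ν * e) with hD
  have hD0 : 0 ≤ D := by
    have := h.e_pos
    have := h.w_nonneg
    have := h.ν_nonneg
    positivity
  -- The improved bound is applied to u and −u with M = ‖u‖_∞ itself, so it bounds M in terms of M.
  have key : ∀ δ : ℝ, 0 < δ → M ≤ M / 2 + D * (1 + M) + δ := by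
    intro δ hδ
    have h1 : eLpNorm u ∞ (volume.restrict Ω) ≤ ENNReal.ofReal (M / 2 + D * (1 + M) + δ) := by
      refine eLpNormEssSup_le_of_ae_bound (C := M / 2 + D * (1 + M) + δ) ?_
      filter_upwards [h.ae_le_of_abs_le hM0 hu hδ, h.neg.ae_le_of_abs_le hM0 hu' hδ] with x h1 h2
      rw [Real.norm_eq_abs, abs_le]
      exact ⟨by linarith, h1⟩
    rw [hMeq] at h1
    exact (ENNReal.ofReal_le_ofReal_iff (by positivity)).1 h1
  have h1 : M ≤ M / 2 + D * (1 + M) := le_of_forall_pos_le_add key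
  rw [hMeq]
  refine ENNReal.ofReal_le_ofReal ?_
  -- By `hq`, D ≤ 1/4, so D M is absorbed as well and M ≤ 4D.
  nlinarith

end IsSmallSolution

/-! ### Solvability in `H₀¹` -/

section Solvability

variable {Ω : Set Plane} {W₁ W₂ : Plane → Plane} {V : Plane → ℝ}

/-- The operator representing the bilinear form of the equation on the graph space. -/
noncomputable def graphOperator (hW₁ : MemLp W₁ ∞ (volume.restrict Ω))
    (hW₂ : MemLp W₂ ∞ (volume.restrict Ω)) (hV : MemLp V ∞ (volume.restrict Ω)) :
    GraphSpace Ω →L[ℝ] GraphSpace Ω :=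
  (WithLp.prodContinuousLinearEquiv 2 ℝ (Lp ℝ 2 (volume.restrict Ω))
      (Lp Plane 2 (volume.restrict Ω))).symm.toContinuousLinearMap.comp
    (ContinuousLinearMap.prod
      (((innerSL ℝ : Plane →L[ℝ] Plane →L[ℝ] ℝ).holderL _ ∞ 2 2 hW₂.toLp).comp
          (WithLp.sndL 2 ℝ _ _) +
        ((ContinuousLinearMap.mul ℝ ℝ).holderL _ ∞ 2 2 hV.toLp).comp (WithLp.fstL 2 ℝ _ _))
      (WithLp.sndL 2 ℝ _ _ +
        ((ContinuousLinearMap.lsmul ℝ ℝ : ℝ →L[ℝ] Plane →L[ℝ] Plane).flip.holderL _ ∞ 2 2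
          hW₁.toLp).comp (WithLp.fstL 2 ℝ _ _)))

lemma inner_graphOperator (hW₁ : MemLp W₁ ∞ (volume.restrict Ω))
    (hW₂ : MemLp W₂ ∞ (volume.restrict Ω)) (hV : MemLp V ∞ (volume.restrict Ω))
    (U Φ : GraphSpace Ω) :
    inner ℝ (graphOperator hW₁ hW₂ hV U) Φ =
      ∫ x in Ω, (inner ℝ (U.snd x + U.fst x • W₁ x) (Φ.snd x) +
        (inner ℝ (W₂ x) (U.snd x) + V x * U.fst x) * Φ.fst x) := by
  rw [WithLp.prod_inner_apply, L2.inner_def, L2.inner_def,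
    ← integral_add (L2.integrable_inner _ _) (L2.integrable_inner _ _)]
  refine integral_congr_ae ?_
  have h1 := Lp.coeFn_add
    ((innerSL ℝ : Plane →L[ℝ] Plane →L[ℝ] ℝ).holder 2 (hW₂.toLp W₂) U.snd)
    ((ContinuousLinearMap.mul ℝ ℝ).holder 2 (hV.toLp V) U.fst)
  have h2 := (innerSL ℝ : Plane →L[ℝ] Plane →L[ℝ] ℝ).coeFn_holder (r := 2) (hW₂.toLp W₂) U.snd
  have h3 := (ContinuousLinearMap.mul ℝ ℝ).coeFn_holder (r := 2) (hV.toLp V) U.fst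
  have h4 := Lp.coeFn_add U.snd
    ((ContinuousLinearMap.lsmul ℝ ℝ : ℝ →L[ℝ] Plane →L[ℝ] Plane).flip.holder 2
      (hW₁.toLp W₁) U.fst)
  have h5 := (ContinuousLinearMap.lsmul ℝ ℝ : ℝ →L[ℝ] Plane →L[ℝ] Plane).flip.coeFn_holder
    (r := 2) (hW₁.toLp W₁) U.fst
  filter_upwards [h1, h2, h3, h4, h5, hW₁.coeFn_toLp, hW₂.coeFn_toLp, hV.coeFn_toLp]
    with x h1 h2 h3 h4 h5 h6 h7 h8
  have e1 : (graphOperator hW₁ hW₂ hV U).ofLp.1 x = inner ℝ (W₂ x) (U.snd x) + V x * U.fst x := by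
    refine h1.trans ?_
    rw [Pi.add_apply, h2, h3, h7, h8]
    rfl
  have e2 : (graphOperator hW₁ hW₂ hV U).ofLp.2 x = U.snd x + U.fst x • W₁ x := by
    refine h4.trans ?_
    rw [Pi.add_apply, h5, h6]
    rfl
  rw [e1, e2, add_comm]
  congr 1
  exact mul_comm _ _

/-- Coercivity of the bilinear form of the equation on `H₀¹`. -/
lemma graphOperator_coercive [IsFiniteMeasure (volume.restrict Ω)]
    (hW₁ : MemLp W₁ ∞ (volume.restrict Ω))
    (hW₂ : MemLp W₂ ∞ (volume.restrict Ω)) (hV : MemLp V ∞ (volume.restrict Ω))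
    {e w w₂ ν : ℝ} (he : 0 < e) (hP : PoincareBound Ω e)
    (hw : 0 ≤ w) (hw₂ : 0 ≤ w₂) (hν : 0 ≤ ν)
    (h₁ : ∀ᵐ x ∂volume.restrict Ω, ‖W₁ x‖ ≤ w) (h₂ : ∀ᵐ x ∂volume.restrict Ω, ‖W₂ x‖ ≤ w₂)
    (hV' : ∀ᵐ x ∂volume.restrict Ω, |V x| ≤ ν)
    (hsmall : w * e + w₂ * e + ν * e ^ 2 ≤ 1 / 2) {U : GraphSpace Ω} (hU : U ∈ sobolevGraph Ω) :
    1 / (2 * (1 + e ^ 2)) * ‖U‖ ^ 2 ≤ inner ℝ (graphOperator hW₁ hW₂ hV U) U := by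
  have hU' := hasH01Gradient_of_mem_sobolevGraph hU
  have hpo := hP _ _ hU'
  set n := l2Norm Ω U.fst with hn
  set g := l2Norm Ω U.snd with hg
  have hn0 : 0 ≤ n := l2Norm_nonneg _
  have hg0 : 0 ≤ g := l2Norm_nonneg _
  have hnorm : ‖U‖ ^ 2 = n ^ 2 + g ^ 2 := by
    rw [WithLp.prod_norm_sq_eq_of_L2]
    rfl
  have hfm := hU'.memLp
  have hgm := hU'.memLp_grad
  have i1 : Integrable (fun x => ‖U.snd x‖ ^ 2) (volume.restrict Ω) := hgm.integrable_norm_pow'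
  have i2 : Integrable (fun x => ‖U.fst x‖ * ‖U.snd x‖) (volume.restrict Ω) :=
    hfm.norm.integrable_mul hgm.norm
  have i3 : Integrable (fun x => ‖U.fst x‖ ^ 2) (volume.restrict Ω) := hfm.integrable_norm_pow'
  have b2 : ∫ x in Ω, ‖U.fst x‖ * ‖U.snd x‖ ≤ n * g := by
    have := integral_mul_le_l2Norm hfm.norm hgm.norm
    rwa [l2Norm_norm, l2Norm_norm] at this
  have i23 : Integrable (fun x => (w + w₂) * (‖U.fst x‖ * ‖U.snd x‖) + ν * ‖U.fst x‖ ^ 2)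
    (volume.restrict Ω) := (i2.const_mul _).add (i3.const_mul _)
  have hlow : g ^ 2 - ((w + w₂) * (∫ x in Ω, ‖U.fst x‖ * ‖U.snd x‖) + ν * n ^ 2) ≤
      inner ℝ (graphOperator hW₁ hW₂ hV U) U := by
    rw [inner_graphOperator, hg, hn, ← integral_norm_sq_eq_l2Norm hgm,
      ← integral_norm_sq_eq_l2Norm hfm, ← integral_const_mul, ← integral_const_mul,
      ← integral_add (i2.const_mul _) (i3.const_mul _), ← integral_sub i1 i23]
    refine integral_mono_ae (i1.sub i23) ?_ ?_
    · refine (integrable_inner_of_memLp (hgm.add ?_) hgm).add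
        (MemLp.integrable_mul (p := 2) (q := 2) (MemLp.add ?_ ?_) hfm)
      · exact hW₁.smul hfm
      · refine hgm.of_le_mul (c := w₂) (hW₂.1.inner hgm.1) ?_
        filter_upwards [h₂] with x hx
        exact (norm_inner_le_norm _ _).trans (mul_le_mul_of_nonneg_right hx (norm_nonneg _))
      · exact hfm.mul hV
    · filter_upwards [h₁, h₂, hV'] with x h1 h2 h3
      have hf := norm_nonneg (U.fst x)
      have hG := norm_nonneg (U.snd x)
      have k1 : -(w * (‖U.fst x‖ * ‖U.snd x‖)) ≤ U.fst x * inner ℝ (W₁ x) (U.snd x) := by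
        refine (neg_le_neg ?_).trans (neg_abs_le _)
        rw [abs_mul, ← Real.norm_eq_abs, mul_left_comm]
        exact mul_le_mul_of_nonneg_left ((abs_real_inner_le_norm _ _).trans
          (mul_le_mul_of_nonneg_right h1 hG)) hf
      have k2 : -(w₂ * (‖U.fst x‖ * ‖U.snd x‖)) ≤ inner ℝ (W₂ x) (U.snd x) * U.fst x := by
        refine (neg_le_neg ?_).trans (neg_abs_le _)
        rw [abs_mul, ← Real.norm_eq_abs (U.fst x), mul_comm _ ‖U.fst x‖, mul_left_comm]
        exact mul_le_mul_of_nonneg_left ((abs_real_inner_le_norm _ _).trans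
          (mul_le_mul_of_nonneg_right h2 hG)) hf
      have k3 : -(ν * ‖U.fst x‖ ^ 2) ≤ V x * U.fst x * U.fst x := by
        refine (neg_le_neg ?_).trans (neg_abs_le _)
        rw [abs_mul, abs_mul, ← Real.norm_eq_abs (U.fst x), mul_assoc, ← sq]
        exact mul_le_mul_of_nonneg_right h3 (sq_nonneg _)
      simp only [inner_add_left, real_inner_smul_left, real_inner_self_eq_norm_sq]
      linarith
  -- Poincaré's inequality bounds ∫|u||∇u| by e g² and ∫u² by e² g²; `hsmall` then leaves half of
  -- g².
  have hmain : g ^ 2 / 2 ≤ inner ℝ (graphOperator hW₁ hW₂ hV U) U := by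
    refine le_trans ?_ hlow
    have q1 : (w + w₂) * (∫ x in Ω, ‖U.fst x‖ * ‖U.snd x‖) ≤ (w + w₂) * (e * g * g) :=
      mul_le_mul_of_nonneg_left (b2.trans (mul_le_mul_of_nonneg_right hpo hg0)) (by positivity)
    have q2 : ν * n ^ 2 ≤ ν * (e * g) ^ 2 :=
      mul_le_mul_of_nonneg_left (pow_le_pow_left₀ hn0 hpo 2) hν
    have q3 := mul_le_mul_of_nonneg_right hsmall (sq_nonneg g)
    linarith
  refine le_trans ?_ hmain
  rw [hnorm, div_mul_eq_mul_div, one_mul, div_le_iff₀ (by positivity)]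
  have := pow_le_pow_left₀ hn0 hpo 2
  linarith

/-- The load vector of the equation for `φ - 1`. -/
noncomputable def loadVector [IsFiniteMeasure (volume.restrict Ω)]
    (hW₁ : MemLp W₁ ∞ (volume.restrict Ω)) (hV : MemLp V ∞ (volume.restrict Ω)) : GraphSpace Ω :=
  WithLp.toLp 2 ((hV.mono_exponent le_top).toLp, (hW₁.mono_exponent le_top).toLp)

lemma inner_loadVector [IsFiniteMeasure (volume.restrict Ω)]
    (hW₁ : MemLp W₁ ∞ (volume.restrict Ω)) (hV : MemLp V ∞ (volume.restrict Ω))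
    (Φ : GraphSpace Ω) :
    inner ℝ (loadVector hW₁ hV) Φ =
      ∫ x in Ω, (inner ℝ (W₁ x) (Φ.snd x) + V x * Φ.fst x) := by
  rw [WithLp.prod_inner_apply, L2.inner_def, L2.inner_def,
    ← integral_add (L2.integrable_inner _ _) (L2.integrable_inner _ _)]
  refine integral_congr_ae ?_
  have h1 := (hV.mono_exponent (p := 2) le_top).coeFn_toLp
  have h2 := (hW₁.mono_exponent (p := 2) le_top).coeFn_toLp
  filter_upwards [h1, h2] with x h1 h2
  have e1 : (loadVector hW₁ hV).ofLp.1 x = V x := h1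
  have e2 : (loadVector hW₁ hV).ofLp.2 x = W₁ x := h2
  rw [e1, e2, add_comm]
  congr 1
  exact mul_comm _ _

/-- The weak formulation for `φ = 1 + u` in the graph space. -/
lemma weak_iff_forall_inner_eq_zero [IsFiniteMeasure (volume.restrict Ω)]
    (hW₁ : MemLp W₁ ∞ (volume.restrict Ω))
    (hW₂ : MemLp W₂ ∞ (volume.restrict Ω)) (hV : MemLp V ∞ (volume.restrict Ω))
    (U : GraphSpace Ω) :
    (∀ η, IsTestFunction Ω η → ∫ x in Ω, (inner ℝ (U.snd x) (gradient η x) +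
      (1 + U.fst x) * inner ℝ (W₁ x) (gradient η x) + inner ℝ (W₂ x) (U.snd x) * η x +
      V x * (1 + U.fst x) * η x) = 0) ↔
    ∀ Φ ∈ sobolevGraph Ω, inner ℝ (graphOperator hW₁ hW₂ hV U + loadVector hW₁ hV) Φ = 0 := by
  have key : ∀ η, ∀ hη : IsTestFunction Ω η,
      inner ℝ (graphOperator hW₁ hW₂ hV U + loadVector hW₁ hV) hη.hasH01Gradient.toGraph =
      ∫ x in Ω, (inner ℝ (U.snd x) (gradient η x) +
      (1 + U.fst x) * inner ℝ (W₁ x) (gradient η x) + inner ℝ (W₂ x) (U.snd x) * η x +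
      V x * (1 + U.fst x) * η x) := by
    intro η hη
    have hfm := Lp.memLp U.fst
    have hgm := Lp.memLp U.snd
    set Φ := hη.hasH01Gradient.toGraph
    have hΦ1 := Lp.memLp Φ.fst
    have hΦ2 := Lp.memLp Φ.snd
    have i1 : Integrable (fun x => inner ℝ (U.snd x + U.fst x • W₁ x) (Φ.snd x) +
        (inner ℝ (W₂ x) (U.snd x) + V x * U.fst x) * Φ.fst x) (volume.restrict Ω) := by
      refine (integrable_inner_of_memLp (hgm.add (hW₁.smul hfm)) hΦ2).add
        (MemLp.integrable_mul (p := 2) (q := 2) (MemLp.add ?_ (hfm.mul hV)) hΦ1)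
      exact hgm.of_bilin (fun a b => inner ℝ b a) 1 hW₂ (hW₂.1.inner hgm.1)
        (.of_forall fun x => by
          rw [one_mul, mul_comm]
          exact nnnorm_inner_le_nnnorm _ _)
    have i2 : Integrable (fun x => inner ℝ (W₁ x) (Φ.snd x) + V x * Φ.fst x)
        (volume.restrict Ω) :=
      (integrable_inner_of_memLp (hW₁.mono_exponent le_top) hΦ2).add
        ((hV.mono_exponent (p := 2) le_top).integrable_mul hΦ1)
    rw [inner_add_left, inner_graphOperator, inner_loadVector, ← integral_add i1 i2]
    refine integral_congr_ae ?_
    filter_upwards [hη.hasH01Gradient.coeFn_toGraph_fst, hη.hasH01Gradient.coeFn_toGraph_snd]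
      with x h1 h2
    rw [h1, h2]
    simp only [inner_add_left, real_inner_smul_left]
    ring
  constructor
  · intro h Φ hΦ
    have hc : IsClosed {Φ : GraphSpace Ω |
        inner ℝ (graphOperator hW₁ hW₂ hV U + loadVector hW₁ hV) Φ = 0} :=
      isClosed_eq (continuous_const.inner continuous_id) continuous_const
    refine closure_minimal (t := {Φ : GraphSpace Ω |
        inner ℝ (graphOperator hW₁ hW₂ hV U + loadVector hW₁ hV) Φ = 0}) ?_ hc hΦ
    rintro Φ ⟨η, hη, h1, h2⟩
    have e : Φ = hη.hasH01Gradient.toGraph := by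
      have e1 : Φ.fst = hη.hasH01Gradient.toGraph.fst :=
        Lp.ext (h1.trans hη.hasH01Gradient.coeFn_toGraph_fst.symm)
      have e2 : Φ.snd = hη.hasH01Gradient.toGraph.snd :=
        Lp.ext (h2.trans hη.hasH01Gradient.coeFn_toGraph_snd.symm)
      exact WithLp.ofLp_injective 2 (Prod.ext e1 e2)
    rw [Set.mem_ofPred_eq, e, key η hη]
    exact h η hη
  · intro h η hη
    rw [← key η hη]
    exact h _ hη.hasH01Gradient.toGraph_mem

/-- The Lax–Milgram theorem for a coercive operator on a closed subspace. -/
lemma existsUnique_forall_inner_eq_zero {E : Type*} [NormedAddCommGroup E] [InnerProductSpace ℝ E]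
    [CompleteSpace E] {K : Submodule ℝ E} (hK : IsClosed (K : Set E)) (A : E →L[ℝ] E)
    {C : ℝ} (hC : 0 < C) (hcoer : ∀ U ∈ K, C * ‖U‖ ^ 2 ≤ inner ℝ (A U) U) (T : E) :
    ∃ U ∈ K, (∀ Φ ∈ K, inner ℝ (A U + T) Φ = 0) ∧
      ∀ U' ∈ K, (∀ Φ ∈ K, inner ℝ (A U' + T) Φ = 0) → U' = U := by
  have hcomp : CompleteSpace K := hK.completeSpace_coe
  obtain ⟨B, hBdef⟩ : ∃ B : K →L[ℝ] K →L[ℝ] ℝ, ∀ U Φ : K, B U Φ = inner ℝ (A U) (Φ : E) :=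
    ⟨ContinuousLinearMap.bilinearComp (innerSL ℝ) (A.comp K.subtypeL) K.subtypeL,
      fun _ _ => rfl⟩
  have hB : IsCoercive B := ⟨C, hC, fun U => by
    rw [hBdef, mul_assoc, ← sq]
    exact hcoer U U.2⟩
  set ℓ : StrongDual ℝ K := (innerSL ℝ (-T)).comp K.subtypeL
  have hℓ : ∀ Φ : K, ℓ Φ = inner ℝ (-T) (Φ : E) := fun _ => rfl
  set v := hB.continuousLinearEquivOfBilin.symm ((InnerProductSpace.toDual ℝ _).symm ℓ) with hv
  refine ⟨v, v.2, fun Φ hΦ => ?_, fun U' hU' h' => ?_⟩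
  · have h1 := hB.continuousLinearEquivOfBilin_apply v ⟨Φ, hΦ⟩
    rw [hv, ContinuousLinearEquiv.apply_symm_apply, InnerProductSpace.toDual_symm_apply, ← hv,
      hℓ, hBdef] at h1
    rw [inner_add_left, ← h1, inner_neg_left, neg_add_cancel]
  · have h1 : ∀ w : K, inner ℝ ((InnerProductSpace.toDual ℝ K).symm ℓ) w = B ⟨U', hU'⟩ w := by
      intro w
      rw [InnerProductSpace.toDual_symm_apply, hℓ, hBdef]
      have := h' w w.2
      rw [inner_add_left] at this
      rw [inner_neg_left]
      linarith
    rw [hv, hB.unique_continuousLinearEquivOfBilin h1, ContinuousLinearEquiv.symm_apply_apply]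

end Solvability

/-! ### Poincaré constants -/

/-- Strict inequality yields an admissible constant below e, so it need not be known that the
infimum is attained. -/
lemma poincareBound_of_lt {Ω : Set Plane} {e : ℝ} (he : 0 ≤ e)
    (h : poincareConstant Ω < ENNReal.ofReal e) : PoincareBound Ω e := by
  obtain ⟨k, hk, hke⟩ := sInf_lt_iff.1 h
  intro v H hv
  have h1 : eLpNorm v 2 (volume.restrict Ω) ≤
      ENNReal.ofReal e * eLpNorm H 2 (volume.restrict Ω) :=
    (hk v H hv).trans (mul_le_mul_left hke.le _)
  have h2 := ENNReal.toReal_mono (ENNReal.mul_ne_top ENNReal.ofReal_ne_top hv.memLp_grad.2.ne) h1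
  rwa [ENNReal.toReal_mul, ENNReal.toReal_ofReal he] at h2

/-- Sobolev's inequality followed by Cauchy–Schwarz on all of Ω. This is the source of the power of
|Ω| in the final estimate. -/
lemma poincareBound_sobolev {Ω : Set Plane} (hb : Bornology.IsBounded Ω) {S : ℝ}
    (hS : sobolevConst ≤ S) : PoincareBound Ω (S * (volume Ω).toReal ^ (1 / 2 : ℝ)) := by
  intro v H hv
  have h1 := hv.eLpNorm_le_of_support hb MeasurableSet.univ (fun x hx => absurd trivial hx)
  rw [Measure.restrict_apply_univ] at h1
  have h2 := ENNReal.toReal_mono (ENNReal.mul_ne_top ENNReal.coe_ne_top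
    (ENNReal.mul_ne_top hv.memLp_grad.2.ne
      (ENNReal.rpow_ne_top_of_nonneg (by norm_num) hb.measure_lt_top.ne))) h1
  rw [ENNReal.toReal_mul, ENNReal.toReal_mul, ← ENNReal.toReal_rpow, ENNReal.coe_toReal] at h2
  refine h2.trans ?_
  have h3 : 0 ≤ (eLpNorm H 2 (volume.restrict Ω)).toReal * (volume Ω).toReal ^ (1 / 2 : ℝ) := by
    positivity
  have h4 := mul_le_mul_of_nonneg_right hS h3
  rw [l2Norm]
  linarith

lemma ae_norm_le_supNorm {E : Type*} [NormedAddCommGroup E] {Ω : Set Plane} {f : Plane → E}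
    (hf : MemLp f ∞ (volume.restrict Ω)) : ∀ᵐ x ∂volume.restrict Ω, ‖f x‖ ≤ supNorm Ω f := by
  filter_upwards [enorm_ae_le_eLpNormEssSup f (volume.restrict Ω)] with x hx
  rw [← eLpNorm_exponent_top] at hx
  have := ENNReal.toReal_mono hf.2.ne hx
  rwa [toReal_enorm] at this

/-! ### The boundary value problem -/

/-- If `φ = 1 + u` solves the equation, then `u` solves an equation with small coefficients. -/
lemma isSmallSolution_of_weak {Ω : Set Plane} (hb : Bornology.IsBounded Ω) {e : ℝ}
    (he : 0 < e) (hP : PoincareBound Ω e) {W₁ W₂ : Plane → Plane} {V : Plane → ℝ}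
    (hW₁ : MemLp W₁ ∞ (volume.restrict Ω)) (hW₂ : MemLp W₂ ∞ (volume.restrict Ω))
    (hV : MemLp V ∞ (volume.restrict Ω))
    (hsmall : supNorm Ω W₁ * e + supNorm Ω W₂ * e + supNorm Ω V * e ^ 2 ≤ 1 / 2)
    {u : Plane → ℝ} {G : Plane → Plane} (hH : HasH01Gradient Ω u G) (hum : Measurable u)
    (hweak : ∀ η, IsTestFunction Ω η → ∫ x in Ω, (inner ℝ (G x) (gradient η x) +
      (1 + u x) * inner ℝ (W₁ x) (gradient η x) + inner ℝ (W₂ x) (G x) * η x +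
      V x * (1 + u x) * η x) = 0) :
    IsSmallSolution Ω e (supNorm Ω W₁) (supNorm Ω W₂) (supNorm Ω V) u G
      (fun x => (1 + u x) • W₁ x) W₂ (fun x => V x * (1 + u x)) := by
  have : IsFiniteMeasure (volume.restrict Ω) := isFiniteMeasure_restrict.2 hb.measure_lt_top.ne
  have hb1 : ∀ x, |1 + u x| ≤ 1 + |u x| := fun x =>
    (abs_add_le _ _).trans (by rw [abs_one])
  have hu1 : MemLp (fun x => 1 + u x) 2 (volume.restrict Ω) := (memLp_const (1 : ℝ)).add hH.memLp
  have hF : MemLp (fun x => (1 + u x) • W₁ x) 2 (volume.restrict Ω) := MemLp.smul (p := 2) hW₁ hu1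
  have hf : MemLp (fun x => V x * (1 + u x)) 2 (volume.restrict Ω) := MemLp.mul (p := ∞) hu1 hV
  have hFle : ∀ᵐ x ∂volume.restrict Ω, ‖(1 + u x) • W₁ x‖ ≤ supNorm Ω W₁ * (1 + |u x|) := by
    filter_upwards [ae_norm_le_supNorm hW₁] with x hx
    rw [norm_smul, mul_comm]
    exact mul_le_mul hx (hb1 x) (norm_nonneg _) ENNReal.toReal_nonneg
  have hfle : ∀ᵐ x ∂volume.restrict Ω, |V x * (1 + u x)| ≤ supNorm Ω V * (1 + |u x|) := by
    filter_upwards [ae_norm_le_supNorm hV] with x hx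
    rw [abs_mul]
    exact mul_le_mul hx (hb1 x) (abs_nonneg _) ENNReal.toReal_nonneg
  exact
    { bounded := hb
      hasGradient := hH
      measurable := hum
      e_pos := he
      poincare := hP
      w_nonneg := ENNReal.toReal_nonneg
      w₂_nonneg := ENNReal.toReal_nonneg
      ν_nonneg := ENNReal.toReal_nonneg
      memLp_F := hF
      memLp_f := hf
      aesm_W₂ := hW₂.1
      norm_F_le := hFle
      norm_W₂_le := ae_norm_le_supNorm hW₂
      abs_f_le := hfle
      integral_eq := fun η hη => by
        rw [← hweak η hη]
        refine integral_congr_ae (.of_forall fun x => ?_)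
        simp only [inner_add_left, real_inner_smul_left]
        ring
      small := hsmall }

/-- Well-posedness and the supremum bound in terms of an admissible Poincaré constant. -/
theorem exists_weakSolution {Ω : Set Plane} (hb : Bornology.IsBounded Ω) (hΩ : IsOpen Ω) {e : ℝ}
    (he : 0 < e) (hP : PoincareBound Ω e) {W₁ W₂ : Plane → Plane} {V : Plane → ℝ}
    (hW₁ : MemLp W₁ ∞ (volume.restrict Ω)) (hW₂ : MemLp W₂ ∞ (volume.restrict Ω))
    (hV : MemLp V ∞ (volume.restrict Ω))
    (hsmall : supNorm Ω W₁ * e + supNorm Ω W₂ * e + supNorm Ω V * e ^ 2 ≤ 1 / 2)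
    (hsmall' : 256 * barrierConst ^ 2 * e * (supNorm Ω W₁ + supNorm Ω V * e) ≤ 1) :
    ∃ φ : Plane → ℝ,
      (IsWeakSolution Ω W₁ W₂ V φ ∧ MemH01 Ω (fun x => φ x - 1)) ∧
      (∀ ψ : Plane → ℝ, IsWeakSolution Ω W₁ W₂ V ψ → MemH01 Ω (fun x => ψ x - 1) →
        ψ =ᵐ[volume.restrict Ω] φ) ∧
      eLpNorm (fun x => φ x - 1) ∞ (volume.restrict Ω) ≤
        ENNReal.ofReal (256 * barrierConst ^ 2 * e * (supNorm Ω W₁ + supNorm Ω V * e)) := by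
  have : IsFiniteMeasure (volume.restrict Ω) := isFiniteMeasure_restrict.2 hb.measure_lt_top.ne
  have hw : 0 ≤ supNorm Ω W₁ := ENNReal.toReal_nonneg
  have hw₂ : 0 ≤ supNorm Ω W₂ := ENNReal.toReal_nonneg
  have hν : 0 ≤ supNorm Ω V := ENNReal.toReal_nonneg
  have h₁ := ae_norm_le_supNorm hW₁
  have h₂ := ae_norm_le_supNorm hW₂
  have hV' := ae_norm_le_supNorm hV
  obtain ⟨U, hU, hsol, huniq⟩ := existsUnique_forall_inner_eq_zero (isClosed_sobolevGraph Ω)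
    (graphOperator hW₁ hW₂ hV) (C := 1 / (2 * (1 + e ^ 2))) (by positivity)
    (fun U hU => graphOperator_coercive hW₁ hW₂ hV he hP hw hw₂ hν h₁ h₂ hV' hsmall hU)
    (loadVector hW₁ hV)
  have hweak := (weak_iff_forall_inner_eq_zero hW₁ hW₂ hV U).2 hsol
  have hH := hasH01Gradient_of_mem_sobolevGraph hU
  refine ⟨fun x => U.fst x + 1, ⟨⟨U.snd, hH.add_const 1, fun η hη => ?_⟩, U.snd, ?_⟩,
    fun ψ hψ hψ1 => ?_, ?_⟩
  · rw [← hweak η hη]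
    refine integral_congr_ae (.of_forall fun x => ?_)
    simp only [add_comm (1 : ℝ)]
  · simpa using hH
  · obtain ⟨Gψ, hGψ, hψw⟩ := hψ
    obtain ⟨G', hG'⟩ := hψ1
    -- The weak formulation and membership in H₀¹ each supply a gradient for ψ; they must be
    -- identified before uniqueness in the graph space applies.
    have hae : Gψ =ᵐ[volume.restrict Ω] G' :=
      hGψ.gradient_unique hΩ (by simpa using hG'.add_const 1)
    have hfst := hG'.coeFn_toGraph_fst
    have hsnd := hG'.coeFn_toGraph_snd
    have heq : hG'.toGraph = U := by
      refine huniq _ hG'.toGraph_mem ((weak_iff_forall_inner_eq_zero hW₁ hW₂ hV _).1 ?_)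
      intro η hη
      rw [← hψw η hη]
      refine integral_congr_ae ?_
      filter_upwards [hae, hfst, hsnd] with x h1 h2 h3
      rw [h1, h2, h3, add_sub_cancel]
    rw [heq] at hfst
    filter_upwards [hfst] with x hx
    rw [hx, sub_add_cancel]
  · simp only [add_sub_cancel_right]
    exact (isSmallSolution_of_weak hb he hP hW₁ hW₂ hV hsmall hH
      (Lp.stronglyMeasurable U.fst).measurable hweak).eLpNorm_top_le hsmall'

/-- Interpolates between the two Poincaré constants, with s = 2/p. -/
lemma le_rpow_mul_rpow_of_le {x a b s : ℝ} (hx : 0 < x) (ha : x ≤ a) (hb : x ≤ b)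
    (hs0 : 0 ≤ s) (hs1 : s ≤ 1) : x ≤ a ^ s * b ^ (1 - s) := by
  calc x = x ^ s * x ^ (1 - s) := by rw [← Real.rpow_add hx]; simp
    _ ≤ _ := mul_le_mul (Real.rpow_le_rpow hx.le ha hs0)
      (Real.rpow_le_rpow hx.le hb (by linarith)) (by positivity)
      (Real.rpow_nonneg (hx.le.trans ha) _)

theorem mainTheorem5 (C' : ℝ) (hC' : 1 ≤ C') (p : ℝ) (hp : 2 < p) :
    ∃ c C : ℝ, 0 < c ∧ 0 < C ∧
      ∀ ε : ℝ, 0 < ε →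
      ∀ Ω : Set Plane, Bornology.IsBounded Ω → IsOpen Ω →
        poincareConstant Ω ^ 2 ≤ ENNReal.ofReal (C' ^ 2 * ε ^ 2) →
      ∀ (W₁ W₂ : Plane → Plane) (V : Plane → ℝ),
        MemLp W₁ ∞ (volume.restrict Ω) → MemLp W₂ ∞ (volume.restrict Ω) →
        MemLp V ∞ (volume.restrict Ω) →
        ε + ε ^ (2 / p) * supNorm Ω W₁ + ε * supNorm Ω W₂ + ε ^ 2 * supNorm Ω V ≤ c →
      ∃ φ : Plane → ℝ,
        (IsWeakSolution Ω W₁ W₂ V φ ∧ MemH01 Ω (fun x => φ x - 1)) ∧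
        (∀ ψ : Plane → ℝ,
          IsWeakSolution Ω W₁ W₂ V ψ → MemH01 Ω (fun x => ψ x - 1) →
          ψ =ᵐ[volume.restrict Ω] φ) ∧
        eLpNorm (fun x => φ x - 1) ∞ (volume.restrict Ω) ≤
          ENNReal.ofReal (C * (ε ^ (2 / p) * (volume Ω).toReal ^ ((p - 2) / (2 * p))
            * supNorm Ω W₁ + ε ^ 2 * supNorm Ω V)) := by
  have hβ := one_le_barrierConst
  set D := 256 * barrierConst ^ 2 with hD
  have hD1 : 256 ≤ D := by nlinarith
  set S : ℝ := (sobolevConst : ℝ) + 1 with hS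
  have hS0 : (sobolevConst : ℝ) ≤ S := by linarith
  have hS1 : 1 ≤ S := by
    have : (0 : ℝ) ≤ sobolevConst := NNReal.coe_nonneg _
    linarith
  have hC4 : 2 * C' ≤ 4 * C' ^ 2 := by nlinarith
  -- The factor 4C'² covers both (2C')², from e², and 2C', from e. D is the constant of the supremum
  -- bound; S ≥ 1 ensures S^{1−2/p} ≤ S.
  refine ⟨1 / (4 * C' ^ 2 * D), D * (4 * C' ^ 2 * S), by positivity, by positivity, ?_⟩
  intro ε hε Ω hb hΩ hPo W₁ W₂ V hW₁ hW₂ hV hc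
  have hw : 0 ≤ supNorm Ω W₁ := ENNReal.toReal_nonneg
  have hw₂ : 0 ≤ supNorm Ω W₂ := ENNReal.toReal_nonneg
  have hν : 0 ≤ supNorm Ω V := ENNReal.toReal_nonneg
  set w := supNorm Ω W₁
  set w₂ := supNorm Ω W₂
  set ν := supNorm Ω V
  have hs0 : 0 ≤ 2 / p := by positivity
  have hs1 : 2 / p ≤ 1 := by rw [div_le_one (by linarith)]; exact hp.le
  have hεw : 0 ≤ ε ^ (2 / p) * w := by positivity
  have hεw₂ : 0 ≤ ε * w₂ := by positivity
  have hεν : 0 ≤ ε ^ 2 * ν := by positivity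
  have hε1 : ε ≤ 1 := by
    have : 1 / (4 * C' ^ 2 * D) ≤ 1 := by
      rw [div_le_one (by positivity)]
      nlinarith
    linarith
  -- The term ε in the smallness hypothesis forces ε ≤ 1, so control of ε^{2/p}‖W₁‖ also controls
  -- ε‖W₁‖, which coercivity needs.
  have hεε : ε ≤ ε ^ (2 / p) := by
    simpa using Real.rpow_le_rpow_of_exponent_ge hε hε1 hs1
  have hsum : ε * w + ε * w₂ + ε ^ 2 * ν ≤ 1 / (4 * C' ^ 2 * D) := by
    have := mul_le_mul_of_nonneg_right hεε hw
    linarith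
  have hsum' : 4 * C' ^ 2 * (ε * w + ε * w₂ + ε ^ 2 * ν) * D ≤ 1 := by
    rw [le_div_iff₀ (by positivity)] at hsum
    linarith
  have hP1 : PoincareBound Ω (2 * C' * ε) := by
    refine poincareBound_of_lt (by positivity) ?_
    have h1 : poincareConstant Ω ≤ ENNReal.ofReal (C' * ε) := by
      rw [← mul_pow, ENNReal.ofReal_pow (by positivity)] at hPo
      exact (ENNReal.pow_le_pow_left_iff two_ne_zero).1 hPo
    refine h1.trans_lt ((ENNReal.ofReal_lt_ofReal_iff (by positivity)).2 ?_)
    nlinarith [mul_pos (show 0 < C' by linarith) hε]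
  -- smallness for every Poincaré constant below `2 C' ε`
  have hsm : ∀ e, 0 < e → e ≤ 2 * C' * ε → w * e + w₂ * e + ν * e ^ 2 ≤ 1 / 2 ∧
      D * e * (w + ν * e) ≤ 1 := by
    intro e he hle
    have h2 : e ^ 2 ≤ (2 * C' * ε) ^ 2 := pow_le_pow_left₀ he.le hle 2
    have a1 : w * e ≤ 4 * C' ^ 2 * (ε * w) := by
      have := mul_le_mul_of_nonneg_left hle hw
      have := mul_le_mul_of_nonneg_right hC4 (mul_nonneg hε.le hw)
      linarith
    have a2 : w₂ * e ≤ 4 * C' ^ 2 * (ε * w₂) := by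
      have := mul_le_mul_of_nonneg_left hle hw₂
      have := mul_le_mul_of_nonneg_right hC4 (mul_nonneg hε.le hw₂)
      linarith
    have a3 : ν * e ^ 2 ≤ 4 * C' ^ 2 * (ε ^ 2 * ν) := by
      have := mul_le_mul_of_nonneg_left h2 hν
      linarith
    have b0 : 0 ≤ w * e + w₂ * e + ν * e ^ 2 := by positivity
    have b1 : (w * e + w₂ * e + ν * e ^ 2) * D ≤ 1 := by
      refine le_trans (mul_le_mul_of_nonneg_right ?_ (by linarith)) hsum'
      linarith
    refine ⟨by nlinarith, ?_⟩
    have : 0 ≤ w₂ * e * D := by positivity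
    linarith
  -- For null Ω the Sobolev constant S|Ω|^{1/2} vanishes and cannot serve as a positive e, but the
  -- supremum bound is then trivial.
  rcases eq_or_ne (volume Ω) 0 with h0 | h0
  · obtain ⟨s1, s2⟩ := hsm (2 * C' * ε) (by positivity) le_rfl
    obtain ⟨φ, h1, h2, -⟩ := exists_weakSolution hb hΩ (by positivity) hP1 hW₁ hW₂ hV s1 s2
    refine ⟨φ, h1, h2, ?_⟩
    rw [Measure.restrict_eq_zero.2 h0, eLpNorm_measure_zero]
    exact zero_le
  set m := (volume Ω).toReal with hm
  have hm0 : 0 < m := ENNReal.toReal_pos h0 hb.measure_lt_top.ne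
  -- Smallness holds for every e ≤ 2C'ε, so the smaller of the two constants can be used in the
  -- supremum bound.
  set e := min (2 * C' * ε) (S * m ^ (1 / 2 : ℝ)) with he
  have he0 : 0 < e := lt_min (by positivity) (by positivity)
  have hle1 : e ≤ 2 * C' * ε := min_le_left _ _
  have hle2 : e ≤ S * m ^ (1 / 2 : ℝ) := min_le_right _ _
  have hP : PoincareBound Ω e := by
    rcases min_choice (2 * C' * ε) (S * m ^ (1 / 2 : ℝ)) with h | h
    · rwa [he, h]
    · rw [he, h]
      exact poincareBound_sobolev hb hS0
  obtain ⟨s1, s2⟩ := hsm e he0 hle1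
  obtain ⟨φ, h1, h2, h3⟩ := exists_weakSolution hb hΩ he0 hP hW₁ hW₂ hV s1 s2
  refine ⟨φ, h1, h2, h3.trans (ENNReal.ofReal_le_ofReal ?_)⟩
  have k1 : e ≤ 4 * C' ^ 2 * S * (ε ^ (2 / p) * m ^ ((p - 2) / (2 * p))) := by
    refine (le_rpow_mul_rpow_of_le he0 hle1 hle2 hs0 hs1).trans ?_
    have e1 : (2 * C' * ε) ^ (2 / p) ≤ 4 * C' ^ 2 * ε ^ (2 / p) := by
      rw [Real.mul_rpow (by positivity) hε.le]
      refine mul_le_mul_of_nonneg_right (le_trans ?_ hC4) (by positivity)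
      exact Real.rpow_le_self_of_one_le (by linarith) hs1
    have e2 : (S * m ^ (1 / 2 : ℝ)) ^ (1 - 2 / p) ≤ S * m ^ ((p - 2) / (2 * p)) := by
      rw [Real.mul_rpow (by positivity) (by positivity), ← Real.rpow_mul hm0.le]
      have : (1 / 2 : ℝ) * (1 - 2 / p) = (p - 2) / (2 * p) := by
        have : p ≠ 0 := by linarith
        field_simp
      rw [this]
      refine mul_le_mul_of_nonneg_right ?_ (by positivity)
      exact Real.rpow_le_self_of_one_le hS1 (by linarith)
    refine (mul_le_mul e1 e2 (by positivity) (by positivity)).trans (le_of_eq ?_)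
    ring
  have k2 : e ^ 2 ≤ 4 * C' ^ 2 * S * ε ^ 2 := by
    have := pow_le_pow_left₀ he0.le hle1 2
    have h5 : 4 * C' ^ 2 * ε ^ 2 * 1 ≤ 4 * C' ^ 2 * ε ^ 2 * S :=
      mul_le_mul_of_nonneg_left hS1 (by positivity)
    linarith
  have k3 := mul_le_mul_of_nonneg_right k1 hw
  have k4 := mul_le_mul_of_nonneg_right k2 hν
  have k5 := mul_le_mul_of_nonneg_left (add_le_add k3 k4) (show 0 ≤ D by linarith)
  linarith
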